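/- A monoid variety is a class of monoids, in the signature $\{\cdot,1\}$, closed under homomorphic images, submonoids and arbitrary direct products; $\mathbb{V}\mathcal{K}$ denotes the monoid variety generated by a class $\mathcal{K}$ of monoids. A variety is finitely based if it is defined by a finite set of identities, finitely generated if it is generated by a finite monoid, small if it has only finitely many subvarieties, Cross if it has all three properties, and of type $2^{\aleph_0}$ if it has exactly continuum many subvarieties. It satisfies the ascending chain condition if its lattice of subvarieties does. For a word $\mathbf{w}$ over a countably infinite alphabet $\mathscr{A}$, let $\mathsf{M}(\mathbf{w})$ be the Rees quotient of the free monoid $\mathscr{A}^*$ by the ideal of all words that are not factors of $\mathbf{w}$, and let $\mathbb{M}(\mathbf{w})=\mathbb{V}\{\mathsf{M}(\mathbf{w})\}$. Let $S_3$ be the symmetric group on three symbols, let $L_2$ and $R_2$ be the left-zero and right-zero semigroups of order two, let $A_0=\langle a,b\mid a^2=a,\ b^2=b,\ ab=0\rangle$ (a semigroup of order four with zero), and let $S^1$ denote the semigroup $S$ with an identity element adjoined. The three monoid varieties $\mathbb{V}\{S_3\}$, $\mathbb{V}\{L_2^1,A_0^1,R_2^1\}$ and $\mathbb{M}(x^2)$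 are Cross (and hence satisfy the ascending chain condition). On the other hand, each of the two joins \[ \mathbb{V}\{S_3\}\vee\mathbb{M}(x^2)=\mathbb{V}\{S_3,\mathsf{M}(x^2)\},\qquad \mathbb{V}\{L_2^1,A_0^1,R_2^1\}\vee\mathbb{M}(x^2)=\mathbb{V}\{L_2^1,A_0^1,R_2^1,\mathsf{M}(x^2)\} \] contains $\mathsf{M}(xyxy)$, is of type $2^{\aleph_0}$, and does not satisfy the ascending chain condition. Consequently, there are Cross monoid varieties $\mathcal{U},\mathcal{V}$ such that $\mathcal{U}\vee\mathcal{V}$ is of type $2^{\aleph_0}$ and violates the ascending chain condition. In particular, for monoid varieties the following questions have positive answers: (Jackson) are there finitely generated, small varieties $\mathcal{U},\mathcal{V}$ such that $\mathcal{U}\vee\mathcal{V}$ is of type $2^{\aleph_0}$? (Shevrin et al.) are there varieties $\mathcal{U},\mathcal{V}$ that satisfy the ascending chain condition such that $\mathcal{U}\vee\mathcal{V}$ does not? -/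

import Mathlib

universe u

/-- A monoid variety: a class of monoids, in the signature of multiplication and `1`, that is closed
under homomorphic images, submonoids and arbitrary direct products. -/
structure MonoidVariety where
  carrier : Set MonCat.{u}
  image_mem : ∀ (M N : MonCat.{u}) (f : M →* N), Function.Surjective f → M ∈ carrier → N ∈ carrier
  submonoid_mem : ∀ (M : MonCat.{u}) (S : Submonoid M), M ∈ carrier → MonCat.of S ∈ carrier
  prod_mem : ∀ (ι : Type u) (M : ι → MonCat.{u}), (∀ i, M i ∈ carrier) →
    MonCat.of (∀ i, M i) ∈ carrier

namespace MonoidVariety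

instance : SetLike MonoidVariety.{u} MonCat.{u} where
  coe V := V.carrier
  coe_injective := by
    rintro ⟨_, _, _, _⟩ ⟨_, _, _, _⟩ h
    cases h
    rfl

/-- Varieties are ordered by inclusion of classes. -/
instance : PartialOrder MonoidVariety.{u} := PartialOrder.lift (fun V => (V : Set MonCat.{u}))
  SetLike.coe_injective

/-- The infimum of a set of varieties is their intersection. -/
instance : InfSet MonoidVariety.{u} where
  sInf 𝒮 :=
    { carrier := {M | ∀ V ∈ 𝒮, M ∈ V}
      image_mem := fun M N f hf hM V hV => V.image_mem M N f hf (hM V hV)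
      submonoid_mem := fun M S hM V hV => V.submonoid_mem M S (hM V hV)
      prod_mem := fun ι M hM V hV => V.prod_mem ι M (fun i => hM i V hV) }

/-- The complete lattice of all monoid varieties under inclusion; `⊔` is the join of varieties. -/
instance : CompleteLattice MonoidVariety.{u} :=
  completeLatticeOfInf MonoidVariety.{u} fun _ =>
    ⟨fun _ hV _ hM => hM _ hV, fun _ hU _ hM V hV => hU hV hM⟩

/-- The monoid variety generated by a class of monoids. -/
def generatedBy (K : Set MonCat.{u}) : MonoidVariety.{u} :=
  sInf {V : MonoidVariety.{u} | ∀ M ∈ K, M ∈ V}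

/-- The lattice of all subvarieties of `V`. -/
abbrev Subvarieties (V : MonoidVariety.{u}) : Type (u + 1) := Set.Iic V

end MonoidVariety

/-- Words over a countably infinite alphabet, the empty word included. -/
abbrev MonoidWord : Type := FreeMonoid ℕ

/-- The monoid `M` satisfies the identity `e.1 ≈ e.2`. -/
def SatisfiesIdentity (M : Type u) [Monoid M] (e : MonoidWord × MonoidWord) : Prop :=
  ∀ θ : ℕ → M, FreeMonoid.lift θ e.1 = FreeMonoid.lift θ e.2

namespace MonoidVariety

/-- `Γ` is a basis for `V`: the variety `V` consists of the monoids that satisfy `Γ`. -/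
def IsBasis (V : MonoidVariety.{u}) (Γ : Set (MonoidWord × MonoidWord)) : Prop :=
  ∀ M : MonCat.{u}, M ∈ V ↔ ∀ e ∈ Γ, SatisfiesIdentity M e

def IsFinitelyBased (V : MonoidVariety.{u}) : Prop :=
  ∃ Γ : Set (MonoidWord × MonoidWord), Γ.Finite ∧ V.IsBasis Γ

def IsFinitelyGenerated (V : MonoidVariety.{u}) : Prop :=
  ∃ M : MonCat.{u}, Finite M ∧ V = generatedBy {M}

/-- A variety is small if it has only finitely many subvarieties. -/
def IsSmall (V : MonoidVariety.{u}) : Prop := Finite V.Subvarieties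

structure IsCross (V : MonoidVariety.{u}) : Prop where
  finitelyBased : V.IsFinitelyBased
  finitelyGenerated : V.IsFinitelyGenerated
  small : V.IsSmall

/-- A variety is of type `2^ℵ₀` if it has exactly continuum many subvarieties. -/
def IsOfTypeContinuum (V : MonoidVariety.{u}) : Prop :=
  Cardinal.mk V.Subvarieties = Cardinal.continuum

/-- The ascending chain condition on subvarieties: every ascending sequence
`V₀ ≤ V₁ ≤ ⋯` of subvarieties of `V` is eventually constant. -/
def HasACC (V : MonoidVariety.{u}) : Prop :=
  ∀ c : ℕ →o V.Subvarieties, ∃ n, ∀ m, n ≤ m → c n = c m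

end MonoidVariety

/-- The set of all factors of words in `W`. -/
def factorialClosure (W : Set MonoidWord) : Set MonoidWord :=
  {v | ∃ w ∈ W, ∃ a b : MonoidWord, w = a * v * b}

/-- The Rees congruence of the ideal of all words that are not factors of words in `W`. -/
def reesCon (W : Set MonoidWord) : Con MonoidWord where
  r v w := v = w ∨ (v ∉ factorialClosure W ∧ w ∉ factorialClosure W)
  iseqv :=
    { refl := fun _ => Or.inl rfl
      symm := by
        rintro v w (h | ⟨h₁, h₂⟩)
        · exact Or.inl h.symm
        · exact Or.inr ⟨h₂, h₁⟩
      trans := by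
        rintro v w z (rfl | ⟨h₁, h₂⟩) (rfl | ⟨h₃, h₄⟩)
        · exact Or.inl rfl
        · exact Or.inr ⟨h₃, h₄⟩
        · exact Or.inr ⟨h₁, h₂⟩
        · exact Or.inr ⟨h₁, h₄⟩ }
  mul' := by
    have hl : ∀ v w : MonoidWord, v * w ∈ factorialClosure W → v ∈ factorialClosure W := by
      rintro v w ⟨z, hz, a, b, h⟩
      exact ⟨z, hz, a, w * b, by rw [h]; simp only [mul_assoc]⟩
    have hr : ∀ v w : MonoidWord, v * w ∈ factorialClosure W → w ∈ factorialClosure W := by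
      rintro v w ⟨z, hz, a, b, h⟩
      exact ⟨z, hz, a * v, b, by rw [h]; simp only [mul_assoc]⟩
    rintro v w x y (rfl | ⟨h₁, h₂⟩) (rfl | ⟨h₃, h₄⟩)
    · exact Or.inl rfl
    · exact Or.inr ⟨fun h => h₃ (hr _ _ h), fun h => h₄ (hr _ _ h)⟩
    · exact Or.inr ⟨fun h => h₁ (hl _ _ h), fun h => h₂ (hl _ _ h)⟩
    · exact Or.inr ⟨fun h => h₁ (hl _ _ h), fun h => h₂ (hl _ _ h)⟩

/-- The Rees quotient `𝖬(W)` of the free monoid by the ideal of all words that are not factors of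
words in `W`. -/
abbrev ReesMonoid (W : Set MonoidWord) : Type := (reesCon W).Quotient

/-- The variable `x`. -/
def varX : MonoidWord := FreeMonoid.of 0

/-- The variable `y`. -/
def varY : MonoidWord := FreeMonoid.of 1

/-- The left-zero semigroup of order two. -/
inductive SemigroupL2 : Type
  | a | b

instance : Semigroup SemigroupL2 where
  mul p _ := p
  mul_assoc _ _ _ := rfl

/-- The right-zero semigroup of order two. -/
inductive SemigroupR2 : Type
  | a | b

instance : Semigroup SemigroupR2 where
  mul _ q := q
  mul_assoc _ _ _ := rfl

/-- The semigroup `A₀ = ⟨a, b | a² = a, b² = b, ab = 0⟩` of order four, with the elements `a`, `b`,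
`ba` and `0`. -/
inductive SemigroupA0 : Type
  | a | b | ba | zero

namespace SemigroupA0

/-- The multiplication table of `A₀`. -/
def mul : SemigroupA0 → SemigroupA0 → SemigroupA0
  | a, a => a
  | b, b => b
  | b, a => ba
  | b, ba => ba
  | ba, a => ba
  | _, _ => zero

instance : Semigroup SemigroupA0 where
  mul := mul
  mul_assoc p q r := by cases p <;> cases q <;> cases r <;> rfl

end SemigroupA0

/-- The monoid variety generated by the symmetric group on three symbols. -/
def varietyS3 : MonoidVariety.{0} :=
  MonoidVariety.generatedBy {MonCat.of (Equiv.Perm (Fin 3))}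

/-- The monoid variety generated by `L₂¹`, `A₀¹` and `R₂¹`, where `S¹` is the semigroup `S` with an
identity element adjoined. -/
def varietyLAR : MonoidVariety.{0} :=
  MonoidVariety.generatedBy {MonCat.of (WithOne SemigroupL2), MonCat.of (WithOne SemigroupA0),
    MonCat.of (WithOne SemigroupR2)}

/-- The monoid variety `𝕄(W)` generated by `𝖬(W)`. -/
def reesVariety (W : Set MonoidWord) : MonoidVariety.{0} :=
  MonoidVariety.generatedBy {MonCat.of (ReesMonoid W)}

/-! Every variety containing `𝖬(xyxy)` has continuum many subvarieties and an infinite ascending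
chain of them. An identity of such a variety cannot alter `xyxy`, so erasing all but two letters
shows that it preserves which letters occur exactly twice and which pairs of them interlace
(alternate as `xyxy`). Hence `cycleLang n`, the language of words whose interlacement graph is the
`n`-cycle, is respected by all these identities, and its syntactic monoid `CycleMonoid n` lies in
the variety (`cycleMonoid_mem`).

For `n, m ≥ 4` this monoid violates the identity "cycle word ≈ square word" of length `n` and
satisfies the one of length `m ≠ n`. Indeed, a nonempty substitution instance of a twice-occurring
word inside a word of `cycleLang n` yields a map from the `n`-cycle to the letters of that word
(`exists_vertex_map`). For a square word it would make adjacency transitive, and for a cycle word it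
embeds the `n`-cycle into the `m`-cycle. So sets of lengths embed, with order reversed, into the
lattice of subvarieties. Birkhoff's theorem gives the upper bound on their number.

In both joins `xyxy` is an isoterm: `𝖬(x²)` leaves only the six arrangements of `xxyy` as possible
right sides, and `S₃`, respectively `L₂¹`, `A₀¹`, `R₂¹`, exclude the other five.

The Cross property rests on a normal form in each case. For `𝖬(x²)` it is the list of exponents
truncated at 3. For `S₃`, groups with `x⁶ = 1` and commuting squares are residually subgroups of
`S₃` (`exists_hom_perm`), so a noncommutative subvariety is everything. For `L₂¹`, `A₀¹`, `R₂¹`, the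
identity `xyxzx ≈ xyzx` reduces a word to its first and last occurrences, and sorting these by
adjacent swaps reduces any identity whose sides have equal counts truncated at two to identities in
two letters (`satisfiesIdentity_of_pairs`). -/

/-! ### Preservation of identities under monoid constructions and substitution. -/

theorem SatisfiesIdentity.of_surjective {M N : Type*} [Monoid M] [Monoid N]
    {e : MonoidWord × MonoidWord} (f : M →* N) (hf : Function.Surjective f)
    (h : SatisfiesIdentity M e) : SatisfiesIdentity N e := by
  intro θ
  choose g hg using hf
  have hθ : (FreeMonoid.lift θ : MonoidWord →* N) = f.comp (FreeMonoid.lift (g ∘ θ)) := by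
    rw [FreeMonoid.comp_lift]
    congr 1
    funext i
    simp [hg]
  rw [hθ, MonoidHom.comp_apply, MonoidHom.comp_apply, h]

theorem SatisfiesIdentity.of_injective {M N : Type*} [Monoid M] [Monoid N]
    {e : MonoidWord × MonoidWord} (f : N →* M) (hf : Function.Injective f)
    (h : SatisfiesIdentity M e) : SatisfiesIdentity N e := by
  intro θ
  apply hf
  have hθ : f.comp (FreeMonoid.lift θ) = FreeMonoid.lift (f ∘ θ) := FreeMonoid.comp_lift _ _
  rw [← MonoidHom.comp_apply, ← MonoidHom.comp_apply, hθ, h]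

theorem SatisfiesIdentity.pi {ι : Type*} {M : ι → Type*} [∀ i, Monoid (M i)]
    {e : MonoidWord × MonoidWord} (h : ∀ i, SatisfiesIdentity (M i) e) :
    SatisfiesIdentity (∀ i, M i) e := by
  intro θ
  funext i
  have hθ : (Pi.evalMonoidHom M i).comp (FreeMonoid.lift θ) = FreeMonoid.lift (fun k => θ k i) :=
    FreeMonoid.comp_lift _ _
  have := h i (fun k => θ k i)
  rw [← hθ] at this
  exact this

/-- The substitution instances of an identity hold wherever the identity holds. -/
theorem SatisfiesIdentity.subst {M : Type*} [Monoid M] {u v : MonoidWord}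
    (h : SatisfiesIdentity M (u, v)) (σ : ℕ → MonoidWord) :
    SatisfiesIdentity M (FreeMonoid.lift σ u, FreeMonoid.lift σ v) := by
  intro θ
  have hθ : (FreeMonoid.lift θ).comp (FreeMonoid.lift σ) =
      FreeMonoid.lift (FreeMonoid.lift θ ∘ σ) := FreeMonoid.comp_lift _ _
  have := h (FreeMonoid.lift θ ∘ σ)
  rw [← hθ] at this
  exact this

theorem SatisfiesIdentity.mul_mul {M : Type*} [Monoid M] {u v : MonoidWord}
    (h : SatisfiesIdentity M (u, v)) (a b : MonoidWord) :
    SatisfiesIdentity M (a * u * b, a * v * b) := by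
  intro θ
  have := h θ
  simp only [map_mul] at this ⊢
  rw [this]

theorem satisfiesIdentity_quotient_iff (c : Con MonoidWord) (u v : MonoidWord) :
    SatisfiesIdentity c.Quotient (u, v) ↔
      ∀ σ : ℕ → MonoidWord, c (FreeMonoid.lift σ u) (FreeMonoid.lift σ v) := by
  have key : ∀ σ : ℕ → MonoidWord,
      (FreeMonoid.lift (fun i => (σ i : c.Quotient)) : MonoidWord →* c.Quotient) =
        c.mk'.comp (FreeMonoid.lift σ) := fun σ => by
    rw [FreeMonoid.comp_lift]
    rfl
  constructor
  · intro h σ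
    have := h (fun i => (σ i : c.Quotient))
    rw [key] at this
    exact c.eq.1 this
  · intro h θ
    obtain ⟨σ, rfl⟩ : ∃ σ : ℕ → MonoidWord, θ = fun i => (σ i : c.Quotient) :=
      ⟨fun i => (θ i).out, by funext i; exact (Quotient.out_eq _).symm⟩
    rw [key]
    exact c.eq.2 (h σ)

/-! ### Birkhoff's theorem and the correspondence with equational theories. -/

namespace MonoidVariety

/-- The variety of all monoids that satisfy a set of identities. -/
def modelsOf (Γ : Set (MonoidWord × MonoidWord)) : MonoidVariety.{u} where
  carrier := {M | ∀ e ∈ Γ, SatisfiesIdentity M e}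
  image_mem _ _ f hf hM e he := (hM e he).of_surjective f hf
  submonoid_mem _ S hM e he := (hM e he).of_injective S.subtype Subtype.coe_injective
  prod_mem _ _ hM e he := SatisfiesIdentity.pi fun i => hM i e he

/-- The equational theory of a variety. -/
def identities (V : MonoidVariety.{u}) : Set (MonoidWord × MonoidWord) :=
  {e | ∀ M ∈ V, SatisfiesIdentity M e}

theorem le_modelsOf_iff {V : MonoidVariety.{u}} {Γ : Set (MonoidWord × MonoidWord)} :
    V ≤ modelsOf Γ ↔ Γ ⊆ V.identities :=
  ⟨fun h _ he _ hM => h hM _ he, fun h _ hM _ he => h he _ hM⟩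

open Classical in
/-- Identities over an alphabet of any size reduce to identities over the countable alphabet. -/
theorem lift_eq_lift_of_identities {M : Type u} [Monoid M] (V : MonoidVariety.{u})
    (hM : ∀ e ∈ V.identities, SatisfiesIdentity M e) {u v : FreeMonoid M}
    (huv : ∀ N ∈ V, ∀ h : FreeMonoid M →* N, h u = h v) :
    FreeMonoid.lift (id : M → M) u = FreeMonoid.lift id v := by
  set l : List M := u.toList ++ v.toList with hl
  set e : M → ℕ := fun m => l.idxOf m with he
  -- Letters are coded by their first position in `l`; the default `1` is never reached on letters
  -- of `u` and `v`.
  set g : ℕ → M := fun k => l[k]?.getD 1 with hg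
  have hge : ∀ m ∈ l, g (e m) = m := by
    intro m hm
    have h1 : l.idxOf m < l.length := List.idxOf_lt_length_iff.2 hm
    simp [hg, he, List.getElem?_eq_getElem h1]
  have hmem : (FreeMonoid.map e u, FreeMonoid.map e v) ∈ V.identities := by
    intro N hN θ
    exact huv N hN ((FreeMonoid.lift θ).comp (FreeMonoid.map e))
  have key : ∀ w : FreeMonoid M, (∀ m ∈ w.toList, m ∈ l) →
      FreeMonoid.lift g (FreeMonoid.map e w) = FreeMonoid.lift id w := by
    intro w hw
    rw [FreeMonoid.lift_apply, FreeMonoid.lift_apply, FreeMonoid.toList_map, List.map_map]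
    congr 1
    apply List.map_congr_left
    intro m hm
    exact hge m (hw m hm)
  have := hM _ hmem g
  rw [key u fun m hm => by simp [hl, hm], key v fun m hm => by simp [hl, hm]] at this
  exact this

/-- Birkhoff's theorem: a variety is defined by its identities. -/
theorem modelsOf_identities (V : MonoidVariety.{u}) : modelsOf V.identities = V := by
  refine le_antisymm ?_ (le_modelsOf_iff.2 subset_rfl)
  intro M hM
  -- The product runs over separated pairs of words, with one separating homomorphism for each, so
  -- that the index type stays in universe `u` although `V` is a proper class.
  let I : Type u := {p : FreeMonoid M × FreeMonoid M //
    ∃ N ∈ V, ∃ h : FreeMonoid M →* N, h p.1 ≠ h p.2}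
  choose N hN h hne using fun p : I => p.2
  let H : FreeMonoid M →* (∀ p : I, N p) := MonoidHom.pi h
  have hker : Con.ker H ≤ Con.ker (FreeMonoid.lift (id : M → M)) := by
    intro u v huv
    rw [Con.ker_rel] at huv ⊢
    refine lift_eq_lift_of_identities V hM fun K hK k => ?_
    by_contra hk
    exact hne ⟨(u, v), K, hK, k, hk⟩ (congrFun huv ⟨(u, v), K, hK, k, hk⟩)
  have h1 : MonCat.of (∀ p : I, N p) ∈ V := V.prod_mem I N hN
  have h2 : MonCat.of (MonoidHom.mrange H) ∈ V :=
    V.submonoid_mem (MonCat.of (∀ p : I, N p)) (MonoidHom.mrange H : Submonoid (∀ p : I, N p)) h1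
  have h3 : MonCat.of (Con.ker H).Quotient ∈ V :=
    V.image_mem _ (MonCat.of (Con.ker H).Quotient)
      (Con.quotientKerEquivRange H).symm.toMonoidHom
      (Con.quotientKerEquivRange H).symm.surjective h2
  refine V.image_mem _ M (Con.lift (Con.ker H) (FreeMonoid.lift (id : M → M)) hker) ?_ h3
  refine Con.lift_surjective_of_surjective hker fun m => ⟨FreeMonoid.of m, ?_⟩
  simp

theorem mem_iff_identities {V : MonoidVariety.{u}} {M : MonCat.{u}} :
    M ∈ V ↔ ∀ e ∈ V.identities, SatisfiesIdentity M e := by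
  conv_lhs => rw [← modelsOf_identities V]
  exact Iff.rfl

theorem le_iff_identities {U V : MonoidVariety.{u}} : U ≤ V ↔ V.identities ⊆ U.identities := by
  conv_lhs => rw [← modelsOf_identities V]
  exact le_modelsOf_iff

theorem identities_injective : Function.Injective (identities : MonoidVariety.{u} → _) :=
  fun _ _ h => le_antisymm (le_iff_identities.2 h.ge) (le_iff_identities.2 h.le)

theorem subset_generatedBy (K : Set MonCat.{u}) : ∀ M ∈ K, M ∈ generatedBy K :=
  fun M hM _ hV => hV M hM

theorem generatedBy_le_iff {K : Set MonCat.{u}} {V : MonoidVariety.{u}} :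
    generatedBy K ≤ V ↔ ∀ M ∈ K, M ∈ V :=
  ⟨fun h M hM => h (subset_generatedBy K M hM), fun h _ hM => hM V h⟩

theorem identities_generatedBy (K : Set MonCat.{u}) :
    (generatedBy K).identities = {e | ∀ M ∈ K, SatisfiesIdentity M e} := by
  ext e
  constructor
  · exact fun h M hM => h M (subset_generatedBy K M hM)
  · intro h M hM
    have hle : generatedBy K ≤ modelsOf {e} := generatedBy_le_iff.2 fun N hN e' he' => by
      rw [Set.mem_singleton_iff.1 he']
      exact h N hN
    exact hle hM e rfl

theorem generatedBy_sup (K L : Set MonCat.{u}) :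
    generatedBy K ⊔ generatedBy L = generatedBy (K ∪ L) := by
  apply le_antisymm
  · exact sup_le (generatedBy_le_iff.2 fun M hM => subset_generatedBy _ M (Or.inl hM))
      (generatedBy_le_iff.2 fun M hM => subset_generatedBy _ M (Or.inr hM))
  · refine generatedBy_le_iff.2 fun M hM => hM.elim (fun h => ?_) fun h => ?_
    · exact (le_sup_left : _ ≤ generatedBy K ⊔ generatedBy L) (subset_generatedBy _ M h)
    · exact (le_sup_right : _ ≤ generatedBy K ⊔ generatedBy L) (subset_generatedBy _ M h)

theorem isBasis_of_identities {V : MonoidVariety.{u}} {Γ : Set (MonoidWord × MonoidWord)}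
    (h : Γ ⊆ V.identities)
    (h' : ∀ M : Type u, ∀ [Monoid M], (∀ e ∈ Γ, SatisfiesIdentity M e) →
      ∀ e ∈ V.identities, SatisfiesIdentity M e) : V.IsBasis Γ :=
  fun M => ⟨fun hM _ he => h he M hM, fun hM => mem_iff_identities.2 (h' M hM)⟩

/-- A variety is small if its subvarieties are determined by which identities they satisfy from a
finite list. -/
theorem isSmall_of_finite {V : MonoidVariety.{u}} (F : Set (MonoidWord × MonoidWord))
    (hF : F.Finite)
    (h : ∀ U ≤ V, ∀ W ≤ V, (∀ e ∈ F, e ∈ U.identities → e ∈ W.identities) →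
      U.identities ⊆ W.identities) : V.IsSmall := by
  have := hF.to_subtype
  refine Finite.of_injective (fun U : V.Subvarieties => {e : F | (e : _ × _) ∈ U.1.identities}) ?_
  intro U W hUW
  have hiff : ∀ e ∈ F, e ∈ U.1.identities ↔ e ∈ W.1.identities := fun e he =>
    Set.ext_iff.1 hUW ⟨e, he⟩
  apply Subtype.ext
  apply identities_injective
  exact Set.Subset.antisymm (h _ U.2 _ W.2 fun e he => (hiff e he).1)
    (h _ W.2 _ U.2 fun e he => (hiff e he).2)

theorem IsSmall.hasACC {V : MonoidVariety.{u}} (h : V.IsSmall) : V.HasACC := by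
  have : Finite V.Subvarieties := h
  intro c
  exact WellFoundedGT.monotone_chain_condition c

end MonoidVariety

/-! ### Rees quotients and isoterms. -/

theorem mem_factorialClosure_singleton {w v : MonoidWord} :
    v ∈ factorialClosure {w} ↔ v.toList <:+: w.toList := by
  constructor
  · rintro ⟨_, rfl, a, b, h⟩
    exact ⟨a.toList, b.toList, by rw [h]; simp⟩
  · rintro ⟨a, b, h⟩
    exact ⟨w, rfl, FreeMonoid.ofList a, FreeMonoid.ofList b, FreeMonoid.toList.injective (by
      rw [← h]; simp)⟩

theorem finite_reesMonoid (w : MonoidWord) : Finite (ReesMonoid {w}) := by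
  have hfin : (factorialClosure {w}).Finite := by
    refine Set.Finite.subset (List.finite_toSet (w.toList.sublists.map FreeMonoid.ofList)) ?_
    intro v hv
    have := (mem_factorialClosure_singleton.1 hv).sublist
    simp only [Set.mem_ofPred_eq, List.mem_map, List.mem_sublists]
    exact ⟨v.toList, this, by simp⟩
  have hS : Finite (factorialClosure {w} : Set MonoidWord) := hfin
  by_cases hne : ∃ z : MonoidWord, z ∉ factorialClosure {w}
  · obtain ⟨z, hz⟩ := hne
    refine Finite.of_surjective (fun o : Option (factorialClosure {w} : Set MonoidWord) =>
      ((o.elim z Subtype.val : MonoidWord) : ReesMonoid {w})) ?_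
    intro q
    induction q using Con.induction_on with
    | H v =>
      by_cases hv : v ∈ factorialClosure {w}
      · exact ⟨some ⟨v, hv⟩, rfl⟩
      · exact ⟨none, (Con.eq _).2 (Or.inr ⟨hz, hv⟩)⟩
  · push Not at hne
    refine Finite.of_surjective (fun v : (factorialClosure {w} : Set MonoidWord) =>
      ((v : MonoidWord) : ReesMonoid {w})) ?_
    intro q
    induction q using Con.induction_on with
    | H v => exact ⟨⟨v, hne v⟩, rfl⟩

/-- If a word is an isoterm for a variety then its Rees quotient belongs to the variety. -/
theorem reesMonoid_mem_of_isoterm {V : MonoidVariety.{0}} {w : MonoidWord}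
    (h : ∀ w', (w, w') ∈ V.identities → w' = w) : MonCat.of (ReesMonoid {w}) ∈ V := by
  rw [MonoidVariety.mem_iff_identities]
  rintro ⟨u, v⟩ huv
  refine (satisfiesIdentity_quotient_iff _ _ _).2 fun σ => ?_
  -- A factor of an isoterm is an isoterm: restore the context and cancel it in the free monoid.
  have key : ∀ u v : MonoidWord, (u, v) ∈ V.identities → u ∈ factorialClosure {w} → u = v := by
    rintro u v huv ⟨_, rfl, a, b, hw⟩
    have := h (a * v * b) (by
      intro M hM
      rw [hw]
      exact (huv M hM).mul_mul a b)
    rw [hw] at this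
    exact (mul_left_cancel (mul_right_cancel this)).symm
  have h1 : (FreeMonoid.lift σ u, FreeMonoid.lift σ v) ∈ V.identities :=
    fun M hM => (huv M hM).subst σ
  by_cases hu : FreeMonoid.lift σ u ∈ factorialClosure {w}
  · exact Or.inl (key _ _ h1 hu)
  by_cases hv : FreeMonoid.lift σ v ∈ factorialClosure {w}
  · exact Or.inl (key _ _ (fun M hM θ => (h1 M hM θ).symm) hv).symm
  · exact Or.inr ⟨hu, hv⟩

/-! ### Interlacement of letters in a word. -/

theorem toList_lift_word (σ : ℕ → MonoidWord) (w : MonoidWord) :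
    (FreeMonoid.lift σ w).toList = w.toList.flatMap fun k => (σ k).toList := by
  rw [FreeMonoid.lift_apply, FreeMonoid.toList_prod, List.map_map, List.flatMap_def]
  rfl

theorem flatMap_eq_of_single {α : Type*} {w : List ℕ} {g : ℕ → List α} (p : ℕ)
    (h : ∀ z ∈ w, z ≠ p → g z = []) :
    w.flatMap g = (List.replicate (w.count p) (g p)).flatten := by
  induction w with
  | nil => simp
  | cons z w ih =>
    have ih := ih fun y hy => h y (List.mem_cons_of_mem _ hy)
    by_cases hz : z = p
    · subst hz
      simp [List.flatMap_cons, ih, List.replicate_succ]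
    · simp [List.flatMap_cons, ih, hz, h z (by simp) hz]

/-- The substitution that sends the letters `i` and `j` to `x` and `y` and erases the others. -/
def pairSub (i j k : ℕ) : List ℕ := if k = i then [0] else if k = j then [1] else []

theorem flatMap_pairSub_left {i j : ℕ} {l : List ℕ} (h : j ∉ l) :
    l.flatMap (pairSub i j) = List.replicate (l.count i) 0 := by
  rw [flatMap_eq_of_single i]
  · simp [pairSub]
  · intro z hz hzi
    have : z ≠ j := fun e => h (e ▸ hz)
    simp [pairSub, hzi, this]

theorem flatMap_pairSub_right {i j : ℕ} {l : List ℕ} (h : i ∉ l) :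
    l.flatMap (pairSub i j) = List.replicate (l.count j) 1 := by
  rw [flatMap_eq_of_single j]
  · by_cases hij : j = i
    · subst hij
      simp [List.count_eq_zero_of_not_mem h]
    · simp [pairSub, hij]
  · intro z hz hzj
    have : z ≠ i := fun e => h (e ▸ hz)
    simp [pairSub, hzj, this]

theorem flatMap_pairSub_nil {i j : ℕ} {l : List ℕ} (hi : i ∉ l) (hj : j ∉ l) :
    l.flatMap (pairSub i j) = [] := by
  rw [flatMap_pairSub_left hj, List.count_eq_zero_of_not_mem hi, List.replicate_zero]

/-- The letters `i` and `j` interlace in the word `l`. -/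
def Cross (i j : ℕ) (l : List ℕ) : Prop :=
  l.flatMap (pairSub i j) = [0, 1, 0, 1] ∨ l.flatMap (pairSub j i) = [0, 1, 0, 1]

theorem cross_comm {i j : ℕ} {l : List ℕ} : Cross i j l ↔ Cross j i l := or_comm

/-- Both occurrences of `i` lie in `l`, which `j` avoids, so erasing the other letters puts the two
`i` next to each other. -/
theorem not_cross_of_factor {i j : ℕ} {a l b : List ℕ} (hi : l.count i = 2)
    (hu : (a ++ l ++ b).count i = 2) (hj : j ∉ l) : ¬ Cross i j (a ++ l ++ b) := by
  have ha : i ∉ a := List.count_eq_zero.1 (by simp only [List.count_append] at hu; omega)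
  have hb : i ∉ b := List.count_eq_zero.1 (by simp only [List.count_append] at hu; omega)
  rintro (h | h) <;> rw [List.flatMap_append, List.flatMap_append] at h
  · rw [flatMap_pairSub_right ha, flatMap_pairSub_right hb, flatMap_pairSub_left hj, hi] at h
    generalize a.count j = s at h
    rcases s with _ | s <;> simp [List.replicate_succ] at h
  · rw [flatMap_pairSub_left ha, flatMap_pairSub_left hb, flatMap_pairSub_right hj, hi] at h
    generalize a.count j = s at h
    rcases s with _ | _ | s <;> simp [List.replicate_succ] at h

/-- The block holds both occurrences of `k` and exactly one of `j`; the other `j` lies outside, on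
one side or the other, and either way the letters alternate. -/
theorem cross_of_factor {k j p q : ℕ} {a b : List ℕ} (hkp : k ≠ p) (hkq : k ≠ q) (hpq : p ≠ q)
    (hj : j = p ∨ j = q) (hk : (a ++ [k, p, q, k] ++ b).count k = 2)
    (hj2 : (a ++ [k, p, q, k] ++ b).count j = 2) : Cross k j (a ++ [k, p, q, k] ++ b) := by
  have hkc : [k, p, q, k].count k = 2 := by simp [hkp.symm, hkq.symm]
  have hjc : [k, p, q, k].count j = 1 := by
    rcases hj with rfl | rfl
    · simp [hkp, hpq.symm]
    · simp [hkq, hpq]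
  have h1 : [k, p, q, k].flatMap (pairSub k j) = [0, 1, 0] := by
    rcases hj with rfl | rfl
    · simp [pairSub, hkp.symm, hkq.symm, hpq.symm]
    · simp [pairSub, hkp.symm, hkq.symm, hpq]
  have h2 : [k, p, q, k].flatMap (pairSub j k) = [1, 0, 1] := by
    rcases hj with rfl | rfl
    · simp [pairSub, hkp, hkq.symm, hpq.symm]
    · simp [pairSub, hkp.symm, hkq, hpq]
  have ha : k ∉ a := List.count_eq_zero.1 (by simp only [List.count_append] at hk; omega)
  have hb : k ∉ b := List.count_eq_zero.1 (by simp only [List.count_append] at hk; omega)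
  have hab : a.count j = 0 ∧ b.count j = 1 ∨ a.count j = 1 ∧ b.count j = 0 := by
    simp only [List.count_append] at hj2
    omega
  rcases hab with ⟨h3, h4⟩ | ⟨h3, h4⟩
  · left
    rw [List.flatMap_append, List.flatMap_append, h1, flatMap_pairSub_right ha,
      flatMap_pairSub_right hb, h3, h4]
    rfl
  · right
    rw [List.flatMap_append, List.flatMap_append, h2, flatMap_pairSub_left ha,
      flatMap_pairSub_left hb, h3, h4]
    rfl

theorem flatMap_pairSub_of_count_one {i j : ℕ} (hij : i ≠ j) {l : List ℕ} (hi : l.count i = 1)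
    (hj : l.count j = 1) : l.flatMap (pairSub i j) = [0, 1] ∨ l.flatMap (pairSub j i) = [0, 1] := by
  obtain ⟨s, t, rfl⟩ := List.append_of_mem (List.count_pos_iff.1 (by omega : 0 < l.count i))
  rw [List.count_append, List.count_cons_self] at hi
  rw [List.count_append, List.count_cons_of_ne hij] at hj
  have hs : i ∉ s := List.count_eq_zero.1 (by omega)
  have ht : i ∉ t := List.count_eq_zero.1 (by omega)
  rcases Nat.eq_zero_or_pos (s.count j) with h0 | h0
  · left
    rw [List.flatMap_append, List.flatMap_cons, flatMap_pairSub_right hs, flatMap_pairSub_right ht,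
      h0, show t.count j = 1 by omega]
    simp [pairSub]
  · right
    rw [List.flatMap_append, List.flatMap_cons, flatMap_pairSub_left hs, flatMap_pairSub_left ht,
      show t.count j = 0 by omega, show s.count j = 1 by omega]
    simp [pairSub, hij]

/-! ### Combinatorics of finite cycles. -/

/-- The successor on the cycle with vertices `0, …, n - 1`. -/
def cycSucc (n i : ℕ) : ℕ := if i + 1 = n then 0 else i + 1

/-- Adjacency in the cycle with vertices `0, …, n - 1`. -/
def CycAdj (n i j : ℕ) : Prop := j = cycSucc n i ∨ i = cycSucc n j

theorem cycAdj_comm {n i j : ℕ} : CycAdj n i j ↔ CycAdj n j i := or_comm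

theorem cycSucc_cases {n i : ℕ} (hi : i < n) :
    cycSucc n i = i + 1 ∧ i + 1 < n ∨ cycSucc n i = 0 ∧ i + 1 = n := by
  unfold cycSucc
  split_ifs <;> omega

theorem cycSucc_lt {n i : ℕ} (hi : i < n) : cycSucc n i < n := by
  rcases cycSucc_cases hi with h | h <;> omega

/-- This is where triangles are excluded: from length four on, the ends of a path with two edges are
distinct and not adjacent. -/
theorem not_cycAdj_cycSucc_cycSucc {n i : ℕ} (hn : 4 ≤ n) (hi : i < n) :
    i ≠ cycSucc n (cycSucc n i) ∧ ¬ CycAdj n i (cycSucc n (cycSucc n i)) := by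
  have h1 := cycSucc_cases hi
  have h2 := cycSucc_cases (cycSucc_lt hi)
  have h3 := cycSucc_cases (cycSucc_lt (cycSucc_lt hi))
  unfold CycAdj
  omega

/-- Connectedness of the cycle: walk up from `x` to the last vertex, step to `0`, and walk up again.
-/
theorem forall_of_cycSucc {n : ℕ} {P : ℕ → Prop} (x : ℕ) (hx : x < n) (hP : P x)
    (h : ∀ i < n, P i → P (cycSucc n i)) : ∀ i < n, P i := by
  have up : ∀ s, P s → ∀ d, s + d < n → P (s + d) := by
    intro s hs d
    induction d with
    | zero => exact fun _ => hs
    | succ d ih =>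
      intro hd
      have := h (s + d) (by omega) (ih (by omega))
      rwa [cycSucc, if_neg (by omega)] at this
  have hlast : P (n - 1) := by
    have := up x hP (n - 1 - x) (by omega)
    rwa [show x + (n - 1 - x) = n - 1 by omega] at this
  have h0 : P 0 := by
    have := h (n - 1) (by omega) hlast
    rwa [cycSucc, if_pos (by omega)] at this
  intro i hi
  have := up 0 h0 i (by omega)
  rwa [Nat.zero_add] at this

/-- An injection of a cycle onto an induced subgraph of a cycle is a bijection. -/
theorem cycle_embedding_eq {n m : ℕ} (hn : 4 ≤ n) {f : ℕ → ℕ} (hf : ∀ i < n, f i < m)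
    (hinj : ∀ i < n, ∀ j < n, f i = f j → i = j)
    (hadj : ∀ i < n, ∀ j < n, CycAdj n i j → CycAdj m (f i) (f j)) : n = m := by
  -- The image of `f` is closed under the successor: the two neighbours of `i` go to distinct
  -- neighbours of `f i`, so one of them goes to its successor.
  have hall : ∀ k < m, ∃ i < n, f i = k := by
    refine forall_of_cycSucc (f 0) (hf 0 (by omega)) ⟨0, by omega, rfl⟩ ?_
    rintro _ _ ⟨i, hi, rfl⟩
    obtain ⟨p, hp, hpi⟩ : ∃ p < n, cycSucc n p = i := by
      rcases Nat.eq_zero_or_pos i with rfl | h0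
      · exact ⟨n - 1, by omega, by rw [cycSucc, if_pos (by omega)]⟩
      · exact ⟨i - 1, by omega, by rw [cycSucc, if_neg (by omega)]; omega⟩
    have hs : cycSucc n i < n := by unfold cycSucc; split_ifs <;> omega
    have h1 := hadj i hi _ hs (Or.inl rfl)
    have h2 := hadj i hi p hp (Or.inr hpi.symm)
    have h3 : f (cycSucc n i) ≠ f p := fun e => by
      have := hinj _ hs p hp e
      unfold cycSucc at this hpi
      split_ifs at this hpi <;> omega
    rcases h1 with h1 | h1
    · exact ⟨_, hs, h1⟩
    rcases h2 with h2 | h2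
    · exact ⟨_, hp, h2⟩
    -- Otherwise `f i` is the successor of the images of both neighbours, which would then coincide.
    exfalso
    have h4 := hf _ hs
    have h5 := hf _ hp
    unfold cycSucc at h1 h2
    unfold cycSucc at h3 h4
    split_ifs at h1 h2 h3 h4 <;> omega
  have hle : n ≤ m := by
    have := Finset.card_le_card_of_injOn (s := Finset.range n) (t := Finset.range m) f
      (fun i hi => by simpa using hf i (by simpa using hi))
      (fun i hi j hj => hinj i (by simpa using hi) j (by simpa using hj))
    simpa using this
  have hge : m ≤ n := by
    have := Finset.card_le_card_of_surjOn (s := Finset.range n) (t := Finset.range m) f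
      (fun k hk => by
        obtain ⟨i, hi, h⟩ := hall k (by simpa using hk)
        exact ⟨i, by simpa using hi, h⟩)
    simpa using this
  omega

/-! ### Words whose interlacement graph is a cycle. -/

/-- The words in which each of the letters `0, …, n - 1` occurs twice, no other letter occurs, and
interlacement of letters is adjacency in the cycle. -/
def cycleLang (n : ℕ) : Set MonoidWord :=
  {u | (∀ i, u.toList.count i = if i < n then 2 else 0) ∧
    ∀ i < n, ∀ j < n, i ≠ j → (Cross i j u.toList ↔ CycAdj n i j)}

/-- Every letter of `w` occurs twice, so a letter of the image occurs an even number of times there;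
having only two occurrences in all, it occurs once in the block `σ p` of a unique letter `p`, and
`f` picks this `p`. Two letters in one block interlace because the block is repeated; letters in
different blocks interlace exactly when the letters carrying the blocks do. -/
theorem exists_vertex_map {n : ℕ} (hn : 4 ≤ n) {a b w : List ℕ} {σ : ℕ → List ℕ}
    (hu : FreeMonoid.ofList (a ++ w.flatMap σ ++ b) ∈ cycleLang n) (hw : ∀ p ∈ w, w.count p = 2)
    (hne : w.flatMap σ ≠ []) :
    ∃ f : ℕ → ℕ, (∀ i < n, f i ∈ w) ∧
      ∀ i < n, ∀ j < n, i ≠ j → (CycAdj n i j ↔ f i = f j ∨ Cross (f i) (f j) w) := by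
  obtain ⟨hcount, hcross⟩ := hu
  rw [FreeMonoid.toList_ofList] at hcount hcross
  set l := w.flatMap σ with hl
  have hsum : ∀ k, l.count k = 2 * ∑ p ∈ w.toFinset, (σ p).count k := by
    intro k
    rw [hl, List.count_flatMap, Finset.sum_list_map_count, Finset.mul_sum]
    refine Finset.sum_congr rfl fun p hp => ?_
    rw [hw p (List.mem_toFinset.1 hp)]
    rfl
  have hlt : ∀ k ∈ l, k < n := by
    intro k hk
    by_contra h
    have := hcount k
    rw [if_neg h, List.count_eq_zero] at this
    exact this (by simp [hk])
  have hone : ∀ k ∈ l, ∑ p ∈ w.toFinset, (σ p).count k = 1 := by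
    intro k hk
    have h1 := hcount k
    rw [if_pos (hlt k hk), List.count_append, List.count_append, hsum] at h1
    have h2 : 0 < l.count k := List.count_pos_iff.2 hk
    rw [hsum] at h2
    omega
  -- Once `l` contains `i` it contains both its occurrences, so a neighbour missing from `l` could
  -- not interlace with `i`. Connectedness then puts all letters into `l`.
  have hall : ∀ k < n, k ∈ l := by
    obtain ⟨k, hk⟩ := List.exists_mem_of_ne_nil l hne
    refine forall_of_cycSucc k (hlt k hk) hk ?_
    intro i hi hil
    by_contra hs
    have hsn : cycSucc n i < n  := cycSucc_lt hi
    have hne : i ≠ cycSucc n i := by unfold cycSucc; split_ifs <;> omega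
    have h2 : l.count i = 2 := by rw [hsum, hone i hil]
    have h3 := hcount i
    rw [if_pos hi] at h3
    exact not_cross_of_factor h2 h3 hs ((hcross i hi _ hsn hne).2 (Or.inl rfl))
  have hout : ∀ k < n, k ∉ a ∧ k ∉ b := by
    intro k hk
    have h1 := hcount k
    rw [if_pos hk, List.count_append, List.count_append, hsum, hone k (hall k hk)] at h1
    exact ⟨List.count_eq_zero.1 (by omega), List.count_eq_zero.1 (by omega)⟩
  have hex : ∀ k, ∃ p, k < n → p ∈ w ∧ k ∈ σ p := by
    intro k
    by_cases hk : k < n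
    · obtain ⟨p, hp, hkp⟩ := List.mem_flatMap.1 (hall k hk)
      exact ⟨p, fun _ => ⟨hp, hkp⟩⟩
    · exact ⟨0, fun h => absurd h hk⟩
  choose f hf using hex
  have hf1 : ∀ k < n, (σ (f k)).count k = 1 ∧ ∀ p ∈ w, p ≠ f k → k ∉ σ p := by
    intro k hk
    have h1 := hone k (hall k hk)
    have h2 := List.mem_toFinset.2 (hf k hk).1
    rw [← Finset.add_sum_erase _ _ h2] at h1
    have h3 : 0 < (σ (f k)).count k := List.count_pos_iff.2 (hf k hk).2
    refine ⟨by omega, fun p hp hpk => ?_⟩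
    have h4 : ∑ p ∈ w.toFinset.erase (f k), (σ p).count k = 0 := by omega
    exact List.count_eq_zero.1
      (Finset.sum_eq_zero_iff.1 h4 p (Finset.mem_erase.2 ⟨hpk, List.mem_toFinset.2 hp⟩))
  have hmid : ∀ i < n, ∀ j < n, (a ++ l ++ b).flatMap (pairSub i j) =
      w.flatMap fun p => (σ p).flatMap (pairSub i j) := by
    intro i hi j hj
    rw [List.flatMap_append, List.flatMap_append, flatMap_pairSub_nil (hout i hi).1 (hout j hj).1,
      flatMap_pairSub_nil (hout i hi).2 (hout j hj).2, hl, List.flatMap_assoc]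
    simp
  refine ⟨f, fun i hi => (hf i hi).1, fun i hi j hj hij => ?_⟩
  rw [← hcross i hi j hj hij]
  by_cases hfij : f i = f j
  · refine iff_of_true ?_ (Or.inl hfij)
    have hsame : ∀ p q, p < n → q < n → f p = f q → (σ (f p)).flatMap (pairSub p q) = [0, 1] →
        (a ++ l ++ b).flatMap (pairSub p q) = [0, 1, 0, 1] := by
      intro p q hp hq hpq h
      rw [hmid p hp q hq, flatMap_eq_of_single (f p), hw _ (hf p hp).1, h]
      · rfl
      · intro z hz hzp
        exact flatMap_pairSub_nil ((hf1 p hp).2 z hz hzp) ((hf1 q hq).2 z hz (hpq ▸ hzp))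
    rcases flatMap_pairSub_of_count_one hij (hf1 i hi).1 (hfij ▸ (hf1 j hj).1) with h | h
    · exact Or.inl (hsame i j hi hj hfij h)
    · exact Or.inr (hsame j i hj hi hfij.symm (hfij ▸ h))
  · have hdiff : ∀ p q, p < n → q < n → f p ≠ f q →
        (a ++ l ++ b).flatMap (pairSub p q) = w.flatMap (pairSub (f p) (f q)) := by
      intro p q hp hq hpq
      rw [hmid p hp q hq]
      refine List.flatMap_congr fun z hz => ?_
      by_cases hzp : z = f p
      · subst hzp
        rw [flatMap_pairSub_left ((hf1 q hq).2 _ hz hpq), (hf1 p hp).1]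
        simp [pairSub]
      · by_cases hzq : z = f q
        · subst hzq
          rw [flatMap_pairSub_right ((hf1 p hp).2 _ hz hzp), (hf1 q hq).1]
          simp [pairSub, hpq.symm]
        · rw [flatMap_pairSub_nil ((hf1 p hp).2 z hz hzp) ((hf1 q hq).2 z hz hzq)]
          simp [pairSub, hzp, hzq]
    rw [Cross, hdiff i j hi hj hfij, hdiff j i hj hi (Ne.symm hfij)]
    simp [hfij, Cross]

/-- The word `1 0 2 1 3 2 ⋯ m (m - 1)`. -/
def chainWord : ℕ → List ℕ
  | 0 => []
  | m + 1 => chainWord m ++ [m + 1, m]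

/-- A word in which the letters `0, …, n - 1` interlace in a cycle. -/
def cycleWord (n : ℕ) : List ℕ := chainWord (n - 1) ++ [0, n - 1]

/-- The word `0 0 1 1 ⋯ (n - 1) (n - 1)`. -/
def squareWord (n : ℕ) : List ℕ := (List.range n).flatMap fun k => [k, k]

theorem count_chainWord (m i : ℕ) : (chainWord m).count i =
    (if 1 ≤ i ∧ i ≤ m then 1 else 0) + (if i < m then 1 else 0) := by
  induction m with
  | zero => simp [chainWord]; omega
  | succ m ih =>
    simp only [chainWord, List.count_append, ih, List.count_cons, List.count_nil, beq_iff_eq]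
    split_ifs <;> omega

theorem count_cycleWord {n : ℕ} (hn : 4 ≤ n) (i : ℕ) :
    (cycleWord n).count i = if i < n then 2 else 0 := by
  simp only [cycleWord, List.count_append, count_chainWord, List.count_cons, List.count_nil,
    beq_iff_eq]
  split_ifs <;> omega

theorem count_squareWord (n i : ℕ) : (squareWord n).count i = if i < n then 2 else 0 := by
  induction n with
  | zero => simp [squareWord]
  | succ n ih =>
    have : squareWord (n + 1) = squareWord n ++ [n, n] := by
      simp [squareWord, List.range_succ, List.flatMap_append]
    rw [this, List.count_append, ih]
    simp only [List.count_cons, List.count_nil, beq_iff_eq]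
    split_ifs <;> omega

theorem chainWord_prefix {k m : ℕ} (h : k ≤ m) : chainWord k <+: chainWord m := by
  induction m, h using Nat.le_induction with
  | base => exact List.prefix_rfl
  | succ m _ ih => exact ih.trans (List.prefix_append _ _)

/-- Between the two occurrences of a positive letter stand exactly its two neighbours, so adjacency
can be read off from a factor. The letter `0` has no such factor. -/
theorem cycleWord_factor {n k : ℕ} (hk : 1 ≤ k) (hkn : k < n) :
    ∃ a b, cycleWord n = a ++ [k, k - 1, cycSucc n k, k] ++ b := by
  obtain ⟨k, rfl⟩ := Nat.exists_eq_add_of_le' hk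
  rw [cycSucc]
  split_ifs with h
  · refine ⟨chainWord k, [], ?_⟩
    rw [cycleWord, ← h]
    simp [chainWord]
  · obtain ⟨c, hc⟩ := chainWord_prefix (show k + 2 ≤ n - 1 by omega)
    refine ⟨chainWord k, c ++ [0, n - 1], ?_⟩
    rw [cycleWord, ← hc]
    simp [chainWord]

theorem cross_cycleWord {n : ℕ} (hn : 4 ≤ n) {i j : ℕ} (hi : i < n) (hj : j < n) (hij : i ≠ j) :
    Cross i j (cycleWord n) ↔ CycAdj n i j := by
  have key : ∀ k, 1 ≤ k → k < n → ∀ j < n, k ≠ j → (Cross k j (cycleWord n) ↔ CycAdj n k j) := by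
    intro k hk hkn j hj hkj
    obtain ⟨a, b, hab⟩ := cycleWord_factor hk hkn
    have hck : (cycleWord n).count k = 2 := by rw [count_cycleWord hn, if_pos hkn]
    have hcj : (cycleWord n).count j = 2 := by rw [count_cycleWord hn, if_pos hj]
    have h1 : k ≠ k - 1 := by omega
    have h2 : k ≠ cycSucc n k := by unfold cycSucc; split_ifs <;> omega
    have h3 : k - 1 ≠ cycSucc n k := by unfold cycSucc; split_ifs <;> omega
    have h4 : CycAdj n k j ↔ j = k - 1 ∨ j = cycSucc n k := by
      unfold CycAdj cycSucc
      split_ifs <;> omega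
    rw [h4]
    rw [hab] at hck hcj ⊢
    constructor
    · intro h
      by_contra h5
      push Not at h5
      refine not_cross_of_factor ?_ hck ?_ h
      · simp [h1.symm, h2.symm]
      · simp [h5, hkj.symm]
    · exact fun h => cross_of_factor h1 h2 h3 h hck hcj
  -- The exceptional letter `0` is handled by symmetry, since `j` is then positive.
  rcases Nat.eq_zero_or_pos i with rfl | h0
  · rw [cross_comm, cycAdj_comm]
    exact key j (by omega) hj 0 hi hij.symm
  · exact key i h0 hi j hj hij

theorem cycleWord_mem_cycleLang {n : ℕ} (hn : 4 ≤ n) :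
    FreeMonoid.ofList (cycleWord n) ∈ cycleLang n :=
  ⟨count_cycleWord hn, fun _ hi _ hj hij => cross_cycleWord hn hi hj hij⟩

theorem not_cross_squareWord {n i j : ℕ} (hi : i < n) (hij : i ≠ j) :
    ¬ Cross i j (squareWord n) := by
  have hc : (squareWord n).count i = 2 := by rw [count_squareWord, if_pos hi]
  obtain ⟨s, t, hst⟩ := List.append_of_mem (List.mem_range.2 hi)
  have : squareWord n = s.flatMap (fun k => [k, k]) ++ [i, i] ++ t.flatMap fun k => [k, k] := by
    simp [squareWord, hst, List.flatMap_append]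
  rw [this] at hc ⊢
  exact not_cross_of_factor (by simp) hc (by simp [hij.symm])

theorem squareWord_notMem_cycleLang {n : ℕ} (hn : 4 ≤ n) :
    FreeMonoid.ofList (squareWord n) ∉ cycleLang n := fun h =>
  not_cross_squareWord (show 0 < n by omega) (show 0 ≠ 1 by omega)
    ((h.2 0 (by omega) 1 (by omega) (by omega)).2 (Or.inl (by rw [cycSucc, if_neg (by omega)])))

/-- Distinct letters of a square word never interlace, so the vertex map would turn adjacency into
equality of images. That is transitive, contrary to the path `0, 1, 2`. -/
theorem cycleLang_of_squareWord {n m : ℕ} (hn : 4 ≤ n) {a b : List ℕ} {σ : ℕ → List ℕ}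
    (hne : (squareWord m).flatMap σ ≠ []) :
    FreeMonoid.ofList (a ++ (squareWord m).flatMap σ ++ b) ∉ cycleLang n := by
  intro hu
  have hlt : ∀ p ∈ squareWord m, p < m := fun p hp => by
    by_contra h
    have := count_squareWord m p
    rw [if_neg h, List.count_eq_zero] at this
    exact this hp
  obtain ⟨f, hf, hadj⟩ := exists_vertex_map hn hu
    (fun p hp => by rw [count_squareWord, if_pos (hlt p hp)]) hne
  have key : ∀ i < n, ∀ j < n, i ≠ j → (CycAdj n i j ↔ f i = f j) := by
    intro i hi j hj hij
    rw [hadj i hi j hj hij]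
    refine or_iff_left_of_imp fun h => ?_
    by_contra hne
    exact not_cross_squareWord (hlt _ (hf i hi)) hne h
  have h1 := (key 0 (by omega) 1 (by omega) (by omega)).1
    (Or.inl (by rw [cycSucc, if_neg (by omega)]))
  have h2 := (key 1 (by omega) 2 (by omega) (by omega)).1
    (Or.inl (by rw [cycSucc, if_neg (by omega)]))
  have h3 := (key 0 (by omega) 2 (by omega) (by omega)).2 (h1.trans h2)
  have h4 := (not_cycAdj_cycSucc_cycSucc hn (show 0 < n by omega)).2
  have h5 : cycSucc n 0 = 1 := if_neg (by omega)
  have h6 : cycSucc n 1 = 2 := if_neg (by omega)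
  rw [h5, h6] at h4
  exact h4 h3

/-- Adjacent vertices with equal images would share their other neighbours, which is impossible in a
cycle of length at least four; nonadjacent vertices never have equal images. So the vertex map is
injective and embeds one cycle into the other. -/
theorem cycleLang_of_cycleWord {n m : ℕ} (hn : 4 ≤ n) (hm : 4 ≤ m) {a b : List ℕ}
    {σ : ℕ → List ℕ} (hne : (cycleWord m).flatMap σ ≠ [])
    (hu : FreeMonoid.ofList (a ++ (cycleWord m).flatMap σ ++ b) ∈ cycleLang n) : n = m := by
  have hlt : ∀ p ∈ cycleWord m, p < m := fun p hp => by
    by_contra h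
    have := count_cycleWord hm p
    rw [if_neg h, List.count_eq_zero] at this
    exact this hp
  obtain ⟨f, hf, hadj⟩ := exists_vertex_map hn hu
    (fun p hp => by rw [count_cycleWord hm, if_pos (hlt p hp)]) hne
  have htwin : ∀ i < n, f i ≠ f (cycSucc n i) := by
    intro i hi he
    have hj := cycSucc_lt hi
    have hk := cycSucc_lt hj
    have hjk : cycSucc n i ≠ cycSucc n (cycSucc n i) := by
      rcases cycSucc_cases hj with h | h <;> omega
    obtain ⟨hik, h3⟩ := not_cycAdj_cycSucc_cycSucc hn hi
    have h1 := (hadj _ hj _ hk hjk).1 (Or.inl rfl)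
    rw [← he] at h1
    exact h3 ((hadj _ hi _ hk hik).2 h1)
  have hinj : ∀ i < n, ∀ j < n, f i = f j → i = j := by
    intro i hi j hj he
    by_contra hij
    rcases (hadj i hi j hj hij).2 (Or.inl he) with h | h
    · exact htwin i hi (h ▸ he)
    · exact htwin j hj (h ▸ he.symm)
  refine cycle_embedding_eq hn (fun i hi => hlt _ (hf i hi)) hinj fun i hi j hj h => ?_
  have hij : i ≠ j := by
    rintro rfl
    unfold CycAdj cycSucc at h
    split_ifs at h <;> omega
  have hfij : f i ≠ f j := fun e => hij (hinj i hi j hj e)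
  exact (cross_cycleWord hm (hlt _ (hf i hi)) (hlt _ (hf j hj)) hfij).1
    (((hadj i hi j hj hij).1 h).resolve_left hfij)

/-! ### Syntactic monoids and the subvarieties they separate. -/

/-- The syntactic congruence of a language. -/
def syntacticCon (L : Set MonoidWord) : Con MonoidWord where
  r u v := ∀ a b : MonoidWord, a * u * b ∈ L ↔ a * v * b ∈ L
  iseqv :=
    { refl := fun _ _ _ => Iff.rfl
      symm := fun h a b => (h a b).symm
      trans := fun h h' a b => (h a b).trans (h' a b) }
  mul' := by
    intro u v u' v' h h' a b
    have h1 := h a (u' * b)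
    have h2 := h' (a * v) b
    simp only [mul_assoc] at h1 h2 ⊢
    exact h1.trans h2

/-- The word `xyxy`. -/
def wordXYXY : MonoidWord := varX * varY * varX * varY

theorem toList_wordXYXY : wordXYXY.toList = [0, 1, 0, 1] := rfl

theorem lift_eq_of_reesMonoid {u v w : MonoidWord}
    (h : SatisfiesIdentity (ReesMonoid {w}) (u, v)) (σ : ℕ → MonoidWord)
    (hu : (FreeMonoid.lift σ u).toList <:+: w.toList) :
    FreeMonoid.lift σ v = FreeMonoid.lift σ u := by
  rcases (satisfiesIdentity_quotient_iff _ _ _).1 h σ with h | h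
  · exact h.symm
  · exact absurd (mem_factorialClosure_singleton.2 hu) h.1

/-- Substitute `xy` for the letter and erase the rest: the left side becomes empty or `xyxy`, both
isoterms, and comparing lengths gives the count. -/
theorem count_eq_of_reesMonoid {u v : MonoidWord}
    (h : SatisfiesIdentity (ReesMonoid {wordXYXY}) (u, v)) (i : ℕ)
    (hu : u.toList.count i = 0 ∨ u.toList.count i = 2) :
    v.toList.count i = u.toList.count i := by
  let σ : ℕ → MonoidWord := fun k => if k = i then varX * varY else 1
  have hσ : ∀ w : MonoidWord, (FreeMonoid.lift σ w).toList =
      (List.replicate (w.toList.count i) [0, 1]).flatten := by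
    intro w
    rw [toList_lift_word, flatMap_eq_of_single i]
    · simp only [σ, if_true]
      rfl
    · intro z _ hz
      simp [σ, hz]
  have h1 := lift_eq_of_reesMonoid h σ (by
    rw [hσ, toList_wordXYXY]
    rcases hu with hu | hu <;> rw [hu]
    · exact List.nil_infix
    · exact List.infix_rfl)
  have h2 := congrArg (fun w : MonoidWord => w.toList.length) h1
  simp only [hσ, List.length_flatten, List.map_replicate, List.sum_replicate] at h2
  simpa using h2

theorem toList_lift_pairSub (i j : ℕ) (w : MonoidWord) :
    (FreeMonoid.lift (fun k => FreeMonoid.ofList (pairSub i j k)) w).toList =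
      w.toList.flatMap (pairSub i j) := by
  rw [toList_lift_word]
  rfl

theorem cross_of_reesMonoid {u v : MonoidWord}
    (h : SatisfiesIdentity (ReesMonoid {wordXYXY}) (u, v)) {i j : ℕ}
    (hu : Cross i j u.toList) : Cross i j v.toList := by
  have key : ∀ i j, u.toList.flatMap (pairSub i j) = [0, 1, 0, 1] →
      v.toList.flatMap (pairSub i j) = [0, 1, 0, 1] := by
    intro i j hij
    have := lift_eq_of_reesMonoid h (fun k => FreeMonoid.ofList (pairSub i j k)) (by
      rw [toList_lift_pairSub, hij, toList_wordXYXY])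
    have := congrArg FreeMonoid.toList this
    rwa [toList_lift_pairSub, toList_lift_pairSub, hij] at this
  exact hu.imp (key i j) (key j i)

theorem mem_cycleLang_of_reesMonoid {n : ℕ} {u v : MonoidWord}
    (h : SatisfiesIdentity (ReesMonoid {wordXYXY}) (u, v)) (hu : u ∈ cycleLang n) :
    v ∈ cycleLang n := by
  refine ⟨fun i => ?_, fun i hi j hj hij => ?_⟩
  · rw [← hu.1 i]
    refine count_eq_of_reesMonoid h i ?_
    rw [hu.1 i]
    split_ifs <;> simp
  · rw [← hu.2 i hi j hj hij]
    exact ⟨cross_of_reesMonoid fun θ => (h θ).symm, cross_of_reesMonoid h⟩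

/-- The syntactic monoid of `cycleLang n`. -/
abbrev CycleMonoid (n : ℕ) : Type := (syntacticCon (cycleLang n)).Quotient

/-- An instance in context of an identity of `V` is an identity of `𝖬(xyxy)`, and these never lead
into or out of the language. -/
theorem cycleMonoid_mem {V : MonoidVariety.{0}} (hV : MonCat.of (ReesMonoid {wordXYXY}) ∈ V)
    (n : ℕ) : MonCat.of (CycleMonoid n) ∈ V := by
  rw [MonoidVariety.mem_iff_identities]
  rintro ⟨u, v⟩ huv
  refine (satisfiesIdentity_quotient_iff _ _ _).2 fun σ a b => ?_
  have h : SatisfiesIdentity (ReesMonoid {wordXYXY})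
      (a * FreeMonoid.lift σ u * b, a * FreeMonoid.lift σ v * b) :=
    ((huv _ hV).subst σ).mul_mul a b
  exact ⟨mem_cycleLang_of_reesMonoid h, mem_cycleLang_of_reesMonoid fun θ => (h θ).symm⟩

/-- The identity that distinguishes the cycle of length `n`. -/
def cycleIdentity (n : ℕ) : MonoidWord × MonoidWord :=
  (FreeMonoid.ofList (cycleWord n), FreeMonoid.ofList (squareWord n))

theorem cycleMonoid_not_satisfies {n : ℕ} (hn : 4 ≤ n) :
    ¬ SatisfiesIdentity (CycleMonoid n) (cycleIdentity n) := by
  intro h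
  have := (satisfiesIdentity_quotient_iff _ _ _).1 h FreeMonoid.of 1 1
  have hid : ∀ w : MonoidWord, FreeMonoid.lift FreeMonoid.of w = w := fun w =>
    DFunLike.congr_fun (FreeMonoid.lift_restrict (MonoidHom.id MonoidWord)) w
  rw [hid, hid, one_mul, mul_one, one_mul, mul_one] at this
  exact squareWord_notMem_cycleLang hn (this.1 (cycleWord_mem_cycleLang hn))

theorem cycleMonoid_satisfies {n m : ℕ} (hn : 4 ≤ n) (hm : 4 ≤ m) (hnm : n ≠ m) :
    SatisfiesIdentity (CycleMonoid n) (cycleIdentity m) := by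
  refine (satisfiesIdentity_quotient_iff _ _ _).2 fun σ a b => ?_
  have hmem : ∀ p, p ∈ cycleWord m ↔ p ∈ squareWord m := fun p => by
    rw [← List.count_pos_iff, ← List.count_pos_iff, count_cycleWord hm, count_squareWord]
  have hL : ∀ l : List ℕ, a * FreeMonoid.lift σ (FreeMonoid.ofList l) * b =
      FreeMonoid.ofList (a.toList ++ (l.flatMap fun k => (σ k).toList) ++ b.toList) := by
    intro l
    apply FreeMonoid.toList.injective
    rw [FreeMonoid.toList_mul, FreeMonoid.toList_mul, toList_lift_word]
    rfl
  rw [hL, hL]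
  -- If the substitution erases all letters, the two sides agree; otherwise neither side, in any
  -- context, lies in the language.
  by_cases hne : (cycleWord m).flatMap (fun k => (σ k).toList) = []
  · have hne' : (squareWord m).flatMap (fun k => (σ k).toList) = [] := by
      rw [List.flatMap_eq_nil_iff] at hne ⊢
      exact fun p hp => hne p ((hmem p).2 hp)
    rw [hne, hne']
  · have hne' : (squareWord m).flatMap (fun k => (σ k).toList) ≠ [] := by
      intro h
      rw [List.flatMap_eq_nil_iff] at hne h
      exact hne fun p hp => h p ((hmem p).1 hp)
    exact iff_of_false (fun h => hnm (cycleLang_of_cycleWord hn hm hne h))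
      (cycleLang_of_squareWord hn hne')

namespace MonoidVariety

/-- The subvariety of `V` defined by the cycle identities of lengths `n + 4` with `n ∈ S`. -/
def cycleSubvariety (V : MonoidVariety.{0}) (S : Set ℕ) : V.Subvarieties :=
  ⟨V ⊓ modelsOf ((fun n => cycleIdentity (n + 4)) '' S), Set.mem_Iic.2 inf_le_left⟩

/-- For `n ∈ T \ S` the monoid of the cycle of length `n + 4` satisfies all identities indexed by
`S` but not its own, so it separates the two subvarieties. -/
theorem cycleSubvariety_le_iff {V : MonoidVariety.{0}}
    (hV : MonCat.of (ReesMonoid {wordXYXY}) ∈ V) {S T : Set ℕ} :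
    V.cycleSubvariety S ≤ V.cycleSubvariety T ↔ T ⊆ S := by
  constructor
  · intro h n hn
    by_contra hS
    have h1 : MonCat.of (CycleMonoid (n + 4)) ∈
        V ⊓ modelsOf ((fun n => cycleIdentity (n + 4)) '' S) := by
      have h2 : generatedBy {MonCat.of (CycleMonoid (n + 4))} ≤
          V ⊓ modelsOf ((fun n => cycleIdentity (n + 4)) '' S) := by
        refine le_inf (generatedBy_le_iff.2 ?_) (generatedBy_le_iff.2 ?_)
        · rintro _ rfl
          exact cycleMonoid_mem hV _
        · rintro _ rfl _ ⟨m, hm, rfl⟩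
          refine cycleMonoid_satisfies (by omega) (by omega) fun e => hS ?_
          rwa [show n = m by omega]
      exact h2 (subset_generatedBy _ _ rfl)
    have h3 : MonCat.of (CycleMonoid (n + 4)) ∈
        modelsOf ((fun n => cycleIdentity (n + 4)) '' T) :=
      (le_trans h inf_le_right : V ⊓ modelsOf ((fun n => cycleIdentity (n + 4)) '' S) ≤ _) h1
    exact cycleMonoid_not_satisfies (by omega) (h3 _ ⟨n, hn, rfl⟩)
  · intro h
    have h1 : modelsOf ((fun n => cycleIdentity (n + 4)) '' S) ≤
        modelsOf.{0} ((fun n => cycleIdentity (n + 4)) '' T) :=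
      le_modelsOf_iff.2 fun e he M hM => hM e (Set.image_mono h he)
    exact inf_le_inf_left V h1

/-- There are only countably many identities and a subvariety is determined by a set of them;
conversely, sets of cycle lengths give distinct subvarieties. -/
theorem isOfTypeContinuum_of_mem {V : MonoidVariety.{0}}
    (hV : MonCat.of (ReesMonoid {wordXYXY}) ∈ V) : V.IsOfTypeContinuum := by
  apply le_antisymm
  · have hinj : Function.Injective fun U : V.Subvarieties => U.1.identities :=
      fun U W h => Subtype.ext (identities_injective h)
    have h1 := Cardinal.lift_mk_le_lift_mk_of_injective hinj
    have h2 : Cardinal.mk (Set (MonoidWord × MonoidWord)) = Cardinal.continuum := by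
      rw [Cardinal.mk_set, Cardinal.mk_eq_aleph0, Cardinal.two_power_aleph0]
    rw [h2, Cardinal.lift_continuum, ← Cardinal.lift_continuum.{0, 1}] at h1
    simpa using h1
  · have hinj : Function.Injective V.cycleSubvariety := fun S T h =>
      Set.Subset.antisymm ((cycleSubvariety_le_iff hV).1 h.ge) ((cycleSubvariety_le_iff hV).1 h.le)
    have h1 := Cardinal.lift_mk_le_lift_mk_of_injective hinj
    rw [Cardinal.mk_set, Cardinal.mk_nat, Cardinal.two_power_aleph0] at h1
    simpa using h1

/-- The shrinking tails `Set.Ici k` impose ever fewer cycle identities, hence define strictly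
growing subvarieties. -/
theorem not_hasACC_of_mem {V : MonoidVariety.{0}}
    (hV : MonCat.of (ReesMonoid {wordXYXY}) ∈ V) : ¬ V.HasACC := by
  intro h
  obtain ⟨n, hn⟩ := h
    ⟨fun k => V.cycleSubvariety (Set.Ici k), fun k l hkl =>
      (cycleSubvariety_le_iff hV).2 (Set.Ici_subset_Ici.2 hkl)⟩
  have h1 := (cycleSubvariety_le_iff hV).1 (hn (n + 1) (by omega)).ge
  have h2 : n ∈ Set.Ici (n + 1) := h1 (Set.mem_Ici.2 le_rfl)
  have h3 := Set.mem_Ici.1 h2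
  omega

end MonoidVariety

/-! ### Commutative varieties and `𝕄(x²)`. -/

theorem toList_varX_pow (n : ℕ) : (varX ^ n).toList = List.replicate n 0 := by
  induction n with
  | zero => rfl
  | succ n ih =>
    rw [pow_succ, FreeMonoid.toList_mul, ih, List.replicate_succ']
    rfl

theorem satisfiesIdentity_pow_iff {M : Type*} [Monoid M] {a b : ℕ} :
    SatisfiesIdentity M (varX ^ a, varX ^ b) ↔ ∀ m : M, m ^ a = m ^ b := by
  constructor
  · intro h m
    have := h fun _ => m
    simpa [map_pow, varX] using this
  · intro h θ
    simpa [map_pow, varX] using h (θ 0)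

theorem satisfiesIdentity_comm_iff {M : Type*} [Monoid M] :
    SatisfiesIdentity M (varX * varY, varY * varX) ↔ ∀ a b : M, a * b = b * a := by
  constructor
  · intro h a b
    have := h fun i => if i = 0 then a else b
    simpa [varX, varY] using this
  · intro h θ
    simpa [varX, varY] using h (θ 0) (θ 1)

theorem lift_single {M : Type*} [Monoid M] (i : ℕ) (m : M) (w : MonoidWord) :
    FreeMonoid.lift (fun k => if k = i then m else 1) w = m ^ w.toList.count i := by
  rw [FreeMonoid.lift_apply, List.prod_map_eq_pow_single i]
  · simp
  · intro k hk _
    simp [hk]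

theorem SatisfiesIdentity.pow_count {M : Type*} [Monoid M] {u v : MonoidWord}
    (h : SatisfiesIdentity M (u, v)) (i : ℕ) (m : M) :
    m ^ u.toList.count i = m ^ v.toList.count i := by
  have := h fun k => if k = i then m else 1
  rwa [lift_single, lift_single] at this

theorem satisfiesIdentity_of_comm {M : Type*} [Monoid M] (hc : ∀ a b : M, a * b = b * a)
    {u v : MonoidWord} (h : ∀ i, ∀ m : M, m ^ u.toList.count i = m ^ v.toList.count i) :
    SatisfiesIdentity M (u, v) := by
  intro θ
  let _ : CommMonoid M := { ‹Monoid M› with mul_comm := hc }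
  have key : ∀ w : MonoidWord, ∀ s : Finset ℕ, w.toList.toFinset ⊆ s →
      FreeMonoid.lift θ w = ∏ i ∈ s, θ i ^ w.toList.count i := by
    intro w s hs
    rw [FreeMonoid.lift_apply, Finset.prod_list_map_count]
    refine Finset.prod_subset hs fun i _ hi => ?_
    rw [List.count_eq_zero.2 fun h => hi (List.mem_toFinset.2 h), pow_zero]
  rw [key u _ Finset.subset_union_left, key v _ Finset.subset_union_right]
  exact Finset.prod_congr rfl fun i _ => h i (θ i)

namespace MonoidVariety

/-- Commutative varieties of bounded index and period are determined by their identities between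
powers of a variable. -/
theorem identities_subset_of_comm {U W : MonoidVariety.{u}} {r : ℕ → ℕ} {B : ℕ}
    (hr : ∀ a, r a < B) (hU : ∀ M ∈ U, ∀ m : M, ∀ a, m ^ a = m ^ r a)
    (hW : ∀ M ∈ W, ∀ m : M, ∀ a, m ^ a = m ^ r a)
    (hcomm : (varX * varY, varY * varX) ∈ W.identities)
    (h : ∀ a < B, ∀ b < B, (varX ^ a, varX ^ b) ∈ U.identities →
      (varX ^ a, varX ^ b) ∈ W.identities) : U.identities ⊆ W.identities := by
  rintro ⟨u, v⟩ huv M hM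
  refine satisfiesIdentity_of_comm (satisfiesIdentity_comm_iff.1 (hcomm M hM)) fun i m => ?_
  rw [hW M hM, hW M hM m (v.toList.count i)]
  refine satisfiesIdentity_pow_iff.1 (h _ (hr _) _ (hr _) (fun N hN => ?_) M hM) m
  refine satisfiesIdentity_pow_iff.2 fun n => ?_
  rw [← hU N hN, ← hU N hN]
  exact (huv N hN).pow_count i n

/-- The identities `x ^ a ≈ x ^ b` with exponents below `B`. -/
def powIdentities (B : ℕ) : Set (MonoidWord × MonoidWord) :=
  (fun p : ℕ × ℕ => (varX ^ p.1, varX ^ p.2)) '' (Set.Iio B ×ˢ Set.Iio B)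

theorem finite_powIdentities (B : ℕ) : (powIdentities B).Finite :=
  ((Set.finite_Iio B).prod (Set.finite_Iio B)).image _

theorem mem_powIdentities {B a b : ℕ} (ha : a < B) (hb : b < B) :
    (varX ^ a, varX ^ b) ∈ powIdentities B := ⟨(a, b), ⟨ha, hb⟩, rfl⟩

end MonoidVariety

theorem identities_reesVariety (w : MonoidWord) :
    (reesVariety {w}).identities = {e | SatisfiesIdentity (ReesMonoid {w}) e} := by
  rw [reesVariety, MonoidVariety.identities_generatedBy]
  ext e
  simp

theorem isFinitelyGenerated_reesVariety (w : MonoidWord) :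
    (reesVariety {w}).IsFinitelyGenerated :=
  ⟨MonCat.of (ReesMonoid {w}), finite_reesMonoid w, rfl⟩

theorem infix_varX_sq {l : List ℕ} : l <:+: (varX ^ 2).toList ↔ ∃ k ≤ 2, l = List.replicate k 0 := by
  rw [toList_varX_pow, List.infix_replicate_iff]
  constructor
  · rintro ⟨h1, h2⟩
    exact ⟨_, h1, h2⟩
  · rintro ⟨k, hk, rfl⟩
    simp [hk]

/-- A product that is a factor of `x²` has both its factors among the powers of `x`, and these
commute. -/
theorem comm_reesMonoid_varX_sq :
    SatisfiesIdentity (ReesMonoid {varX ^ 2}) (varX * varY, varY * varX) := by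
  refine (satisfiesIdentity_quotient_iff _ _ _).2 fun σ => ?_
  have key : ∀ a b : MonoidWord, a * b ∈ factorialClosure {varX ^ 2} → a * b = b * a := by
    intro a b h
    rw [mem_factorialClosure_singleton, infix_varX_sq] at h
    obtain ⟨k, -, hk⟩ := h
    have ha := List.eq_replicate_of_mem fun c hc =>
      List.eq_of_mem_replicate (hk ▸ List.mem_append_left b.toList hc : c ∈ List.replicate k 0)
    have hb := List.eq_replicate_of_mem fun c hc =>
      List.eq_of_mem_replicate (hk ▸ List.mem_append_right a.toList hc : c ∈ List.replicate k 0)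
    apply FreeMonoid.toList.injective
    rw [FreeMonoid.toList_mul, FreeMonoid.toList_mul, ha, hb, List.replicate_append_replicate,
      List.replicate_append_replicate, add_comm]
  simp only [map_mul, varX, varY, FreeMonoid.lift_eval_of]
  by_cases h1 : σ 0 * σ 1 ∈ factorialClosure {varX ^ 2}
  · exact Or.inl (key _ _ h1)
  by_cases h2 : σ 1 * σ 0 ∈ factorialClosure {varX ^ 2}
  · exact Or.inl (key _ _ h2).symm
  · exact Or.inr ⟨h1, h2⟩

theorem pow_reesMonoid_varX_sq :
    SatisfiesIdentity (ReesMonoid {varX ^ 2}) (varX ^ 3, varX ^ 4) := by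
  refine (satisfiesIdentity_quotient_iff _ _ _).2 fun σ => ?_
  simp only [map_pow, varX, FreeMonoid.lift_eval_of]
  rcases eq_or_ne (σ 0) 1 with h | h
  · exact Or.inl (by rw [h, one_pow, one_pow])
  · have h0 : 0 < (σ 0).length := by
      rw [Nat.pos_iff_ne_zero]
      exact fun e => h (FreeMonoid.length_eq_zero.1 e)
    have key : ∀ k, 3 ≤ k → σ 0 ^ k ∉ factorialClosure {varX ^ 2} := by
      intro k hk hmem
      have h1 := (mem_factorialClosure_singleton.1 hmem).length_le
      rw [toList_varX_pow, List.length_replicate] at h1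
      have h2 : ∀ k, (σ 0 ^ k).length = k * (σ 0).length := by
        intro k
        induction k with
        | zero => simp
        | succ k ih => rw [pow_succ, FreeMonoid.length_mul, ih]; ring
      have h3 : (σ 0 ^ k).length ≤ 2 := h1
      rw [h2] at h3
      nlinarith
    exact Or.inr ⟨key 3 le_rfl, key 4 (by omega)⟩

/-- Sending `i` to `x` and the rest to `1` leaves powers of `x`, which the Rees quotient
distinguishes up to exponent two and identifies from three on. -/
theorem count_of_reesMonoid_varX_sq {u v : MonoidWord}
    (h : SatisfiesIdentity (ReesMonoid {varX ^ 2}) (u, v)) (i : ℕ) :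
    u.toList.count i = v.toList.count i ∨ 3 ≤ u.toList.count i ∧ 3 ≤ v.toList.count i := by
  have hmem : ∀ k, varX ^ k ∈ factorialClosure {varX ^ 2} ↔ k ≤ 2 := by
    intro k
    rw [mem_factorialClosure_singleton, infix_varX_sq, toList_varX_pow]
    exact ⟨fun ⟨j, hj, e⟩ => by simpa using (congrArg List.length e).trans_le (by simpa using hj),
      fun hk => ⟨k, hk, rfl⟩⟩
  have h1 := (satisfiesIdentity_quotient_iff _ _ _).1 h (fun k => if k = i then varX else 1)
  rw [lift_single, lift_single] at h1
  rcases h1 with h1 | ⟨h1, h2⟩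
  · left
    have := congrArg (fun w : MonoidWord => w.toList.length) h1
    simpa [toList_varX_pow] using this
  · right
    rw [hmem] at h1 h2
    omega

/-- Commutativity and `x³ ≈ x⁴` form a basis: they reduce each word to its exponents truncated at 3,
and `𝖬(x²)` sees exactly these. For the same reason power identities with exponents below 4
determine the subvarieties. -/
theorem isCross_reesVariety_varX_sq : (reesVariety {varX ^ 2}).IsCross := by
  have hcomm : (varX * varY, varY * varX) ∈ (reesVariety {varX ^ 2}).identities := by
    rw [identities_reesVariety]
    exact comm_reesMonoid_varX_sq
  have hpow : (varX ^ 3, varX ^ 4) ∈ (reesVariety {varX ^ 2}).identities := by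
    rw [identities_reesVariety]
    exact pow_reesMonoid_varX_sq
  have hmin : ∀ M : Type, ∀ [Monoid M], SatisfiesIdentity M (varX ^ 3, varX ^ 4) →
      ∀ m : M, ∀ a, m ^ a = m ^ min a 3 := by
    intro M _ h m a
    have h34 := satisfiesIdentity_pow_iff.1 h m
    rcases le_total a 3 with ha | ha
    · rw [min_eq_left ha]
    · rw [min_eq_right ha]
      induction a, ha using Nat.le_induction with
      | base => rfl
      | succ a _ ih => rw [pow_succ, ih, ← pow_succ, h34]
  refine ⟨⟨{(varX * varY, varY * varX), (varX ^ 3, varX ^ 4)}, Set.toFinite _, ?_⟩,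
    isFinitelyGenerated_reesVariety _, ?_⟩
  · refine MonoidVariety.isBasis_of_identities ?_ ?_
    · rintro e (rfl | rfl)
      exacts [hcomm, hpow]
    · rintro M _ hM ⟨u, v⟩ huv
      rw [identities_reesVariety] at huv
      refine satisfiesIdentity_of_comm
        (satisfiesIdentity_comm_iff.1 (hM _ (Or.inl rfl))) fun i m => ?_
      rw [hmin M (hM _ (Or.inr rfl)), hmin M (hM _ (Or.inr rfl)) m (v.toList.count i)]
      congr 1
      have := count_of_reesMonoid_varX_sq huv i
      omega
  · refine MonoidVariety.isSmall_of_finite _ (MonoidVariety.finite_powIdentities 4) ?_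
    intro U hU W hW h
    have hle := MonoidVariety.le_iff_identities.1 hU
    have hle' := MonoidVariety.le_iff_identities.1 hW
    exact MonoidVariety.identities_subset_of_comm (r := fun a => min a 3) (B := 4)
      (fun a => by omega) (fun M hM => hmin M (hle hpow M hM))
      (fun M hM => hmin M (hle' hpow M hM)) (hle' hcomm)
      fun a ha b hb => h _ (MonoidVariety.mem_powIdentities ha hb)

/-! ### Groups of exponent six with commuting squares, and the variety of `S₃`. -/

open Equiv in
-- `G` acts on at most three cosets of `C`, and `g ∉ C` moves the coset of `1`; embed the cosets
-- into `Fin 3` and fix the remaining points.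
theorem exists_hom_perm_of_cover {G : Type*} [Group G] {g : G} (C : Subgroup G) (hg : g ∉ C)
    (f : Fin 3 → G) (hf : ∀ h, ∃ i, (f i)⁻¹ * h ∈ C) : ∃ φ : G →* Perm (Fin 3), φ g ≠ 1 := by
  have hs : Function.Surjective fun i => (f i : G ⧸ C) := by
    intro q
    induction q using QuotientGroup.induction_on with
    | H h =>
      obtain ⟨i, hi⟩ := hf h
      exact ⟨i, QuotientGroup.eq.2 hi⟩
  let ι : G ⧸ C ↪ Fin 3 := ⟨Function.surjInv hs, Function.injective_surjInv hs⟩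
  refine ⟨(Perm.viaEmbeddingHom ι).comp (MulAction.toPermHom G (G ⧸ C)), fun h => hg ?_⟩
  have h1 : MulAction.toPermHom G (G ⧸ C) g = 1 :=
    Perm.viaEmbeddingHom_injective ι (by rw [map_one]; exact h)
  have h2 : g • ((1 : G) : G ⧸ C) = ((1 : G) : G ⧸ C) :=
    DFunLike.congr_fun h1 ((1 : G) : G ⧸ C)
  rw [MulAction.Quotient.smul_coe, smul_eq_mul, mul_one, eq_comm, QuotientGroup.eq] at h2
  simpa using h2

section Metabelian

variable {G : Type*} [Group G]

/-- An element with `z³ = 1` is a square, namely `(z²)²`. -/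
theorem cube_eq_one_commute (hc : ∀ a b : G, a ^ 2 * b ^ 2 = b ^ 2 * a ^ 2) {z w : G}
    (hz : z ^ 3 = 1) (hw : w ^ 3 = 1) : z * w = w * z := by
  have h : ∀ z : G, z ^ 3 = 1 → (z ^ 2) ^ 2 = z := fun z hz => by
    rw [← pow_mul, show 2 * 2 = 3 + 1 by rfl, pow_succ, hz, one_mul]
  have := hc (z ^ 2) (w ^ 2)
  rwa [h z hz, h w hw] at this

/-- In a group whose squares commute, the elements of exponent three form a subgroup. -/
def cubeSubgroup (hc : ∀ a b : G, a ^ 2 * b ^ 2 = b ^ 2 * a ^ 2) : Subgroup G where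
  carrier := {z | z ^ 3 = 1}
  one_mem' := one_pow 3
  mul_mem' {z w} hz hw := by
    have : Commute z w := cube_eq_one_commute hc hz hw
    change (z * w) ^ 3 = 1
    rw [this.mul_pow, show z ^ 3 = 1 from hz, show w ^ 3 = 1 from hw, one_mul]
  inv_mem' {z} hz := by
    change z⁻¹ ^ 3 = 1
    rw [inv_pow, show z ^ 3 = 1 from hz, inv_one]

variable (h6 : ∀ a : G, a ^ 6 = 1) (hc : ∀ a b : G, a ^ 2 * b ^ 2 = b ^ 2 * a ^ 2)

theorem mem_cubeSubgroup {z : G} : z ∈ cubeSubgroup hc ↔ z ^ 3 = 1 := Iff.rfl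

theorem normal_cubeSubgroup : (cubeSubgroup hc).Normal := by
  refine ⟨fun n hn d => ?_⟩
  rw [mem_cubeSubgroup] at hn ⊢
  rw [conj_pow, hn, mul_one, mul_inv_cancel]

include h6 hc in
theorem sq_mem_cubeSubgroup (a : G) : a ^ 2 ∈ cubeSubgroup hc := by
  rw [mem_cubeSubgroup, ← pow_mul]
  exact h6 a

include h6 hc in
-- A commutator is a product of squares, and squares have exponent three because `a⁶ = 1`.
theorem commutator_mem_cubeSubgroup (a b : G) : a * b * a⁻¹ * b⁻¹ ∈ cubeSubgroup hc := by
  have h : a * b * a⁻¹ * b⁻¹ = a ^ 2 * (a⁻¹ * b) ^ 2 * (b ^ 2)⁻¹ := by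
    simp only [pow_two]
    group
  rw [h]
  exact mul_mem (mul_mem (sq_mem_cubeSubgroup h6 hc _) (sq_mem_cubeSubgroup h6 hc _))
    (inv_mem (sq_mem_cubeSubgroup h6 hc _))

-- The group is monolithic, with `g` in the monolith; this situation is reached by factoring out a
-- maximal normal subgroup that avoids `g`.
variable {g : G} (hg : g ≠ 1) (hmono : ∀ K : Subgroup G, K.Normal → g ∉ K → K = ⊥)

include h6 hc in
/-- Conjugation by `c` commutes with any other conjugation on the elements of exponent three. -/
theorem conj_conj_comm {n : G} (hn : n ^ 3 = 1) (c d : G) :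
    c * (d * n * d⁻¹) * c⁻¹ = d * (c * n * c⁻¹) * d⁻¹ := by
  have hn' : (d * c * n * c⁻¹ * d⁻¹) ^ 3 = 1 := by
    have : d * c * n * c⁻¹ * d⁻¹ = (d * c) * n * (d * c)⁻¹ := by group
    rw [this, conj_pow, hn, mul_one, mul_inv_cancel]
  have h1 := cube_eq_one_commute hc
    ((mem_cubeSubgroup hc).1 (commutator_mem_cubeSubgroup h6 hc c d)) hn'
  calc c * (d * n * d⁻¹) * c⁻¹
      = (c * d * c⁻¹ * d⁻¹) * (d * c * n * c⁻¹ * d⁻¹) * (c * d * c⁻¹ * d⁻¹)⁻¹ := by group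
    _ = d * (c * n * c⁻¹) * d⁻¹ := by rw [h1]; group

include h6 hc hg hmono in
-- On the abelian group of elements of exponent three, conjugation by `c` is an involution, as `c²`
-- belongs to that group. Its fixed part `P` and inverted part `Q` are normal because conjugations
-- commute there, and `g` cannot lie in both, so one of them is trivial. Since `n⁻¹ · cnc⁻¹ ∈ Q` and
-- `n · cnc⁻¹ ∈ P`, this decides how `c` acts.
theorem conj_eq_or_inv (hg3 : g ^ 3 = 1) (c : G) :
    (∀ n : G, n ^ 3 = 1 → c * n * c⁻¹ = n) ∨ ∀ n : G, n ^ 3 = 1 → c * n * c⁻¹ = n⁻¹ := by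
  have hcomm := fun {z w : G} => cube_eq_one_commute hc (z := z) (w := w)
  have hcube : ∀ {n : G}, n ^ 3 = 1 → (c * n * c⁻¹) ^ 3 = 1 := fun hn => by
    rw [conj_pow, hn, mul_one, mul_inv_cancel]
  have hcc : ∀ {n : G}, n ^ 3 = 1 → c * (c * n * c⁻¹) * c⁻¹ = n := fun {n} hn => by
    have h1 := hcomm ((mem_cubeSubgroup hc).1 (sq_mem_cubeSubgroup h6 hc c)) hn
    calc c * (c * n * c⁻¹) * c⁻¹ = (c ^ 2 * n) * (c ^ 2)⁻¹ := by rw [pow_two]; group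
      _ = n := by rw [h1]; group
  let P : Subgroup G :=
    { carrier := {n | n ^ 3 = 1 ∧ c * n * c⁻¹ = n}
      one_mem' := by simp
      mul_mem' := by
        rintro a b ⟨ha, ha'⟩ ⟨hb, hb'⟩
        refine ⟨(cubeSubgroup hc).mul_mem ha hb, ?_⟩
        rw [← conj_mul, ha', hb']
      inv_mem' := by
        rintro a ⟨ha, ha'⟩
        refine ⟨(cubeSubgroup hc).inv_mem ha, ?_⟩
        rw [← conj_inv, ha'] }
  let Q : Subgroup G :=
    { carrier := {n | n ^ 3 = 1 ∧ c * n * c⁻¹ = n⁻¹}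
      one_mem' := by simp
      mul_mem' := by
        rintro a b ⟨ha, ha'⟩ ⟨hb, hb'⟩
        refine ⟨(cubeSubgroup hc).mul_mem ha hb, ?_⟩
        rw [← conj_mul, ha', hb', ← mul_inv_rev, hcomm ha hb]
      inv_mem' := by
        rintro a ⟨ha, ha'⟩
        refine ⟨(cubeSubgroup hc).inv_mem ha, ?_⟩
        rw [← conj_inv, ha'] }
  have hP : P.Normal := by
    refine ⟨fun n hn d => ⟨(normal_cubeSubgroup hc).conj_mem n hn.1 d, ?_⟩⟩
    rw [conj_conj_comm h6 hc hn.1, hn.2]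
  have hQ : Q.Normal := by
    refine ⟨fun n hn d => ⟨(normal_cubeSubgroup hc).conj_mem n hn.1 d, ?_⟩⟩
    rw [conj_conj_comm h6 hc hn.1, hn.2, conj_inv]
  by_cases hgP : g ∈ P
  · left
    have hQb : Q = ⊥ := hmono Q hQ fun hgQ => hg (by
      have h1 : g = g⁻¹ := hgP.2.symm.trans hgQ.2
      have h2 : g ^ 2 = 1 := by rw [pow_two]; nth_rewrite 1 [h1]; exact inv_mul_cancel g
      rwa [pow_succ, h2, one_mul] at hg3)
    intro n hn
    have hmem : n⁻¹ * (c * n * c⁻¹) ∈ Q := by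
      refine ⟨(cubeSubgroup hc).mul_mem ((cubeSubgroup hc).inv_mem hn) (hcube hn), ?_⟩
      rw [← conj_mul, hcc hn]
      group
    rw [hQb, Subgroup.mem_bot, inv_mul_eq_one] at hmem
    exact hmem.symm
  · right
    have hPb : P = ⊥ := hmono P hP hgP
    intro n hn
    have hmem : n * (c * n * c⁻¹) ∈ P := by
      refine ⟨(cubeSubgroup hc).mul_mem hn (hcube hn), ?_⟩
      rw [← conj_mul, hcc hn]
      exact hcomm (hcube hn) hn
    rw [hPb, Subgroup.mem_bot] at hmem
    exact eq_inv_of_mul_eq_one_right hmem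

include h6 hc hg hmono in
-- Conjugations fix or invert `n`, so the subgroup generated by `n` is normal; if nontrivial, it
-- contains `g` and, having order three, is generated by it.
theorem eq_pow_of_cube (hg3 : g ^ 3 = 1) {n : G} (hn : n ^ 3 = 1) :
    n = 1 ∨ n = g ∨ n = g ^ 2 := by
  by_cases h1 : n = 1
  · exact Or.inl h1
  right
  have hnormal : (Subgroup.zpowers n).Normal := by
    refine ⟨fun m hm d => ?_⟩
    obtain ⟨k, rfl⟩ := Subgroup.mem_zpowers_iff.1 hm
    have h2 : d * n ^ k * d⁻¹ = (d * n * d⁻¹) ^ k := (conj_zpow).symm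
    rw [h2]
    rcases conj_eq_or_inv h6 hc hg hmono hg3 d with h | h <;> rw [h n hn]
    · exact Subgroup.zpow_mem_zpowers n k
    · exact zpow_mem (inv_mem (Subgroup.mem_zpowers n)) k
  have hgn : g ∈ Subgroup.zpowers n := by
    by_contra h
    have := hmono _ hnormal h
    rw [Subgroup.zpowers_eq_bot] at this
    exact h1 this
  obtain ⟨k, hk⟩ := Subgroup.mem_zpowers_iff.1 hgn
  have hn3 : n ^ (3 : ℤ) = 1 := by exact_mod_cast hn
  have hk' : n ^ (k % 3) = g := by
    rw [← hk]
    conv_rhs => rw [← Int.emod_add_mul_ediv k 3, zpow_add, zpow_mul, hn3, one_zpow, mul_one]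
  have : k % 3 = 0 ∨ k % 3 = 1 ∨ k % 3 = 2 := by omega
  rcases this with h | h | h <;> rw [h] at hk'
  · exact absurd (by simpa using hk'.symm) hg
  · left
    simpa using hk'
  · right
    rw [← hk']
    have : (n ^ (2 : ℤ)) ^ 2 = n ^ 3 * n := by
      rw [← pow_succ]
      norm_cast
      rw [← pow_mul]
    rw [this, hn, one_mul]

include h6 hc hg hmono in
-- The elements with square `1` that centralize the exponent-three subgroup are central, hence form
-- a normal subgroup. It misses `g`, so it is trivial, and `h³` belongs to it.
theorem cube_eq_one_of_centralizes (hg3 : g ^ 3 = 1) {h : G}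
    (hh : ∀ n : G, n ^ 3 = 1 → h * n = n * h) : h ^ 3 = 1 := by
  have hcommute : ∀ a b : G, (∀ n : G, n ^ 3 = 1 → a * n = n * a) → a ^ 2 = 1 → a * b = b * a := by
    intro a b ha ha2
    set n := a * b * a⁻¹ * b⁻¹ with hn
    have hn3 : n ^ 3 = 1 := (mem_cubeSubgroup hc).1 (commutator_mem_cubeSubgroup h6 hc a b)
    have hab : a * b = n * b * a := by rw [hn]; group
    have h1 : b = n * n * b := by
      calc b = a ^ 2 * b := by rw [ha2, one_mul]
        _ = a * (a * b) := by rw [pow_two, mul_assoc]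
        _ = (a * n) * b * a := by rw [hab]; group
        _ = n * (a * b) * a := by rw [ha n hn3]; group
        _ = n * n * b * a ^ 2 := by rw [hab, pow_two]; group
        _ = n * n * b := by rw [ha2, mul_one]
    have h2 : n * n = 1 := by
      have := h1.symm
      rwa [mul_eq_right] at this
    have h3 : n = 1 := by rwa [pow_succ, pow_two, h2, one_mul] at hn3
    rw [hab, h3, one_mul]
  let H : Subgroup G :=
    { carrier := {a | (∀ n : G, n ^ 3 = 1 → a * n = n * a) ∧ a ^ 2 = 1}
      one_mem' := by simp
      mul_mem' := by
        rintro a b ⟨ha, ha2⟩ ⟨hb, hb2⟩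
        refine ⟨fun n hn => by rw [mul_assoc, hb n hn, ← mul_assoc, ha n hn, mul_assoc], ?_⟩
        have : Commute a b := hcommute a b ha ha2
        rw [this.mul_pow, ha2, hb2, one_mul]
      inv_mem' := by
        rintro a ⟨ha, ha2⟩
        have : a⁻¹ = a := inv_eq_of_mul_eq_one_left (by rwa [← pow_two])
        rw [this]
        exact ⟨ha, ha2⟩ }
  have hH : H.Normal := by
    refine ⟨fun a ha d => ⟨fun n hn => ?_, by rw [conj_pow, ha.2, mul_one, mul_inv_cancel]⟩⟩
    have h1 := ha.1 _ ((normal_cubeSubgroup hc).conj_mem n hn d⁻¹)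
    rw [inv_inv] at h1
    calc d * a * d⁻¹ * n = d * (a * (d⁻¹ * n * d)) * d⁻¹ := by group
      _ = n * (d * a * d⁻¹) := by rw [h1]; group
  have hHb : H = ⊥ := hmono H hH fun h => hg (by
    have := h.2
    rwa [pow_succ, this, one_mul] at hg3)
  have hmem : h ^ 3 ∈ H := by
    refine ⟨fun n hn => ?_, by rw [← pow_mul]; exact h6 h⟩
    have h1 : Commute h n := hh n hn
    exact h1.pow_left 3
  rwa [hHb, Subgroup.mem_bot] at hmem

include h6 hc hg hmono in
-- If `g³ = 1`, the exponent-three subgroup is `{1, g, g²}` and contains its centralizer. Either it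
-- is all of `G`, or an outside element `c` is an involution whose subgroup has the powers of `g` as
-- coset representatives. If `g³ ≠ 1`, that subgroup is trivial and `G` has order two.
theorem exists_hom_perm_of_monolithic : ∃ φ : G →* Equiv.Perm (Fin 3), φ g ≠ 1 := by
  by_cases hg3 : g ^ 3 = 1
  · have hN := fun {n : G} => eq_pow_of_cube h6 hc hg hmono hg3 (n := n)
    have hcov : ∀ n : G, n ^ 3 = 1 → ∃ i : Fin 3, ![1, g, g ^ 2] i = n := by
      intro n hn
      rcases hN hn with h | h | h
      · exact ⟨0, h.symm⟩
      · exact ⟨1, h.symm⟩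
      · exact ⟨2, h.symm⟩
    by_cases hex : ∃ c : G, c ^ 3 ≠ 1
    · obtain ⟨c, hc3⟩ := hex
      have hinv : ∀ d : G, d ^ 3 ≠ 1 → ∀ n : G, n ^ 3 = 1 → d * n * d⁻¹ = n⁻¹ := by
        intro d hd
        refine (conj_eq_or_inv h6 hc hg hmono hg3 d).resolve_left fun h => hd ?_
        exact cube_eq_one_of_centralizes h6 hc hg hmono hg3 fun n hn =>
          mul_inv_eq_iff_eq_mul.1 (h n hn)
      -- Conjugation by `c` both fixes and inverts `c²`, so `c⁴ = 1`, and `c⁶ = 1` leaves `c² = 1`.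
      have hc2 : c ^ 2 = 1 := by
        have h1 := hinv c hc3 _ (sq_mem_cubeSubgroup h6 hc c)
        have h2 : c * c ^ 2 * c⁻¹ = c ^ 2 := by group
        rw [h2, eq_inv_iff_mul_eq_one, ← pow_add] at h1
        have h3 := h6 c
        rwa [show 6 = 2 + (2 + 2) by rfl, pow_add, h1, mul_one] at h3
      refine exists_hom_perm_of_cover (Subgroup.zpowers c) (fun h => ?_) ![1, g, g ^ 2] fun h => ?_
      · obtain ⟨k, hk⟩ := Subgroup.mem_zpowers_iff.1 h
        have h2 : g ^ 2 = 1 := by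
          rw [← hk, ← zpow_natCast, ← zpow_mul, mul_comm, zpow_mul, zpow_natCast, hc2, one_zpow]
        rw [pow_succ, h2, one_mul] at hg3
        exact hg hg3
      · by_cases hh : h ^ 3 = 1
        · obtain ⟨i, hi⟩ := hcov h hh
          exact ⟨i, by rw [hi, inv_mul_cancel]; exact one_mem _⟩
        -- Both `h` and `c` act by inversion, so their product centralizes.
        · have h3 : (h * c) ^ 3 = 1 := by
            refine cube_eq_one_of_centralizes h6 hc hg hmono hg3 fun n hn => ?_
            rw [← mul_inv_eq_iff_eq_mul]
            calc h * c * n * (h * c)⁻¹ = h * (c * n * c⁻¹) * h⁻¹ := by group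
              _ = (h * n * h⁻¹)⁻¹ := by rw [hinv c hc3 n hn, conj_inv]
              _ = n := by rw [hinv h hh n hn, inv_inv]
          obtain ⟨i, hi⟩ := hcov _ h3
          refine ⟨i, ?_⟩
          have : (h * c)⁻¹ * h = c⁻¹ := by group
          rw [hi, this]
          exact inv_mem (Subgroup.mem_zpowers c)
    · push Not at hex
      refine exists_hom_perm_of_cover ⊥ (by simpa using hg) ![1, g, g ^ 2] fun h => ?_
      obtain ⟨i, hi⟩ := hcov h (hex h)
      exact ⟨i, by rw [hi, inv_mul_cancel]; exact one_mem _⟩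
  · have hNb : cubeSubgroup hc = ⊥ := hmono _ (normal_cubeSubgroup hc) hg3
    have hsq : ∀ a : G, a ^ 2 = 1 := fun a => by
      have := sq_mem_cubeSubgroup h6 hc a
      rwa [hNb, Subgroup.mem_bot] at this
    have hcomm : ∀ a b : G, a * b = b * a := fun a b => by
      have := commutator_mem_cubeSubgroup h6 hc a b
      rw [hNb, Subgroup.mem_bot] at this
      rwa [mul_inv_eq_one, mul_inv_eq_iff_eq_mul] at this
    -- There are only two cosets here; the third entry is padding.
    refine exists_hom_perm_of_cover ⊥ (by simpa using hg) ![1, g, 1] fun h => ?_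
    by_cases h1 : h = 1
    · exact ⟨0, by simp [h1]⟩
    · refine ⟨1, ?_⟩
      have hgn : g ∈ Subgroup.zpowers h := by
        by_contra hn
        have := hmono _ ⟨fun m hm d => by rwa [hcomm d m, mul_inv_cancel_right]⟩ hn
        rw [Subgroup.zpowers_eq_bot] at this
        exact h1 this
      obtain ⟨k, hk⟩ := Subgroup.mem_zpowers_iff.1 hgn
      have hh2 : h ^ (2 : ℤ) = 1 := by exact_mod_cast hsq h
      have hk' : h ^ (k % 2) = g := by
        rw [← hk]
        conv_rhs => rw [← Int.emod_add_mul_ediv k 2, zpow_add, zpow_mul, hh2, one_zpow, mul_one]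
      have : k % 2 = 0 ∨ k % 2 = 1 := by omega
      rcases this with h | h <;> rw [h] at hk'
      · exact absurd (by simpa using hk'.symm) hg
      · rw [zpow_one] at hk'
        simp [hk']

end Metabelian

/-- A group of exponent six whose squares commute is residually a subgroup of `S₃`. -/
theorem exists_hom_perm {G : Type*} [Group G] (h6 : ∀ a : G, a ^ 6 = 1)
    (hc : ∀ a b : G, a ^ 2 * b ^ 2 = b ^ 2 * a ^ 2) {g : G} (hg : g ≠ 1) :
    ∃ φ : G →* Equiv.Perm (Fin 3), φ g ≠ 1 := by
  -- In the quotient by a maximal normal subgroup avoiding `g`, the image of `g` lies in every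
  -- nontrivial normal subgroup.
  obtain ⟨K, -, hK⟩ := zorn_le_nonempty₀ {K : Subgroup G | K.Normal ∧ g ∉ K}
    (fun c hcS hchain K₀ hK₀ => by
      have hne : c.Nonempty := ⟨K₀, hK₀⟩
      refine ⟨sSup c, ⟨⟨fun n hn d => ?_⟩, fun hgc => ?_⟩, fun K hK => le_sSup hK⟩
      · rw [Subgroup.mem_sSup_of_directedOn hne hchain.directedOn] at hn ⊢
        obtain ⟨K, hK, hn⟩ := hn
        exact ⟨K, hK, (hcS hK).1.conj_mem n hn d⟩
      · rw [Subgroup.mem_sSup_of_directedOn hne hchain.directedOn] at hgc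
        obtain ⟨K, hK, hn⟩ := hgc
        exact (hcS hK).2 hn) ⊥ ⟨inferInstance, by simpa using hg⟩
  obtain ⟨hKn, hgK⟩ := hK.prop
  obtain ⟨φ, hφ⟩ := exists_hom_perm_of_monolithic (G := G ⧸ K) (g := (g : G ⧸ K))
    (fun a => by
      induction a using QuotientGroup.induction_on with
      | H a => rw [← QuotientGroup.mk_pow, h6, QuotientGroup.mk_one])
    (fun a b => by
      induction a using QuotientGroup.induction_on with
      | H a =>
        induction b using QuotientGroup.induction_on with
        | H b => simp only [← QuotientGroup.mk_pow, ← QuotientGroup.mk_mul, hc])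
    (fun h => hgK ((QuotientGroup.eq_one_iff g).1 h))
    (fun L hL hgL => by
      have h1 : L.comap (QuotientGroup.mk' K) ≤ K := by
        refine hK.le_of_ge ⟨hL.comap _, fun h => hgL h⟩ ?_
        intro k hk
        rw [Subgroup.mem_comap, QuotientGroup.mk'_apply, (QuotientGroup.eq_one_iff k).2 hk]
        exact one_mem L
      rw [eq_bot_iff]
      intro q hq
      induction q using QuotientGroup.induction_on with
      | H a => exact Subgroup.mem_bot.2 ((QuotientGroup.eq_one_iff a).2 (h1 hq)))
  exact ⟨φ.comp (QuotientGroup.mk' K), hφ⟩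

theorem mem_identities_varietyS3 {e : MonoidWord × MonoidWord} :
    e ∈ varietyS3.identities ↔ SatisfiesIdentity (Equiv.Perm (Fin 3)) e := by
  rw [varietyS3, MonoidVariety.identities_generatedBy]
  simp

theorem satisfiesIdentity_sq_comm_iff {M : Type*} [Monoid M] :
    SatisfiesIdentity M (varX ^ 2 * varY ^ 2, varY ^ 2 * varX ^ 2) ↔
      ∀ a b : M, a ^ 2 * b ^ 2 = b ^ 2 * a ^ 2 := by
  constructor
  · intro h a b
    have := h fun i => if i = 0 then a else b
    simpa [varX, varY] using this
  · intro h θ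
    simpa [varX, varY] using h (θ 0) (θ 1)

/-- In the monoids of exponent six whose squares commute, distinct elements are separated by
homomorphisms to `S₃`. -/
theorem exists_monoidHom_perm {M : Type*} [Monoid M]
    (h6 : SatisfiesIdentity M (varX ^ 6, varX ^ 0))
    (hc : SatisfiesIdentity M (varX ^ 2 * varY ^ 2, varY ^ 2 * varX ^ 2)) {a b : M} (hab : a ≠ b) :
    ∃ φ : M →* Equiv.Perm (Fin 3), φ a ≠ φ b := by
  have h6 : ∀ m : M, m ^ 6 = 1 := fun m => by
    simpa using satisfiesIdentity_pow_iff.1 h6 m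
  let _ : Group M :=
    { ‹Monoid M› with
      inv := fun m => m ^ 5
      inv_mul_cancel := fun m => (pow_succ m 5).symm.trans (h6 m) }
  obtain ⟨φ, hφ⟩ := exists_hom_perm (G := M) h6 (satisfiesIdentity_sq_comm_iff.1 hc)
    (mul_inv_eq_one.not.2 hab : a * b⁻¹ ≠ 1)
  refine ⟨φ, fun h => hφ ?_⟩
  rw [map_mul, map_inv, h, mul_inv_cancel]

set_option maxRecDepth 4000 in
-- This makes a homomorphism to `S₃` surjective as soon as its image is noncommutative.
theorem perm_three_generated : ∀ p q : Equiv.Perm (Fin 3), p * q ≠ q * p → ∀ r : Equiv.Perm (Fin 3),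
    r = 1 ∨ r = p ∨ r = q ∨ r = p * q ∨ r = q * p ∨ r = p * q * p ∨ r = p * p ∨ r = q * q := by
  decide

set_option maxRecDepth 4000 in
theorem perm_three_pow : ∀ p : Equiv.Perm (Fin 3), p ^ 6 = 1 := by decide

set_option maxRecDepth 4000 in
theorem perm_three_sq_comm : ∀ p q : Equiv.Perm (Fin 3), p ^ 2 * q ^ 2 = q ^ 2 * p ^ 2 := by decide

theorem varietyS3_pow : (varX ^ 6, varX ^ 0) ∈ varietyS3.identities :=
  mem_identities_varietyS3.2 (satisfiesIdentity_pow_iff.2 perm_three_pow)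

theorem varietyS3_sq_comm :
    (varX ^ 2 * varY ^ 2, varY ^ 2 * varX ^ 2) ∈ varietyS3.identities :=
  mem_identities_varietyS3.2 (satisfiesIdentity_sq_comm_iff.2 perm_three_sq_comm)

/-- A noncommutative subvariety of the variety generated by `S₃` is the whole variety. -/
theorem varietyS3_le_of_not_comm {U : MonoidVariety.{0}} (hU : U ≤ varietyS3)
    (hcomm : (varX * varY, varY * varX) ∉ U.identities) : varietyS3 ≤ U := by
  have hle := MonoidVariety.le_iff_identities.1 hU
  refine MonoidVariety.generatedBy_le_iff.2 ?_
  rintro _ rfl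
  obtain ⟨M, hM, hne⟩ : ∃ M ∈ U, ¬ SatisfiesIdentity M (varX * varY, varY * varX) := by
    by_contra h
    push Not at h
    exact hcomm h
  rw [satisfiesIdentity_comm_iff] at hne
  push Not at hne
  obtain ⟨a, b, hab⟩ := hne
  obtain ⟨φ, hφ⟩ := exists_monoidHom_perm (hle varietyS3_pow M hM) (hle varietyS3_sq_comm M hM) hab
  rw [map_mul, map_mul] at hφ
  refine U.image_mem M _ φ (fun r => ?_) hM
  rcases perm_three_generated _ _ hφ r with h | h | h | h | h | h | h | h
  · exact ⟨1, by rw [h, map_one]⟩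
  · exact ⟨a, h.symm⟩
  · exact ⟨b, h.symm⟩
  · exact ⟨a * b, by rw [h, map_mul]⟩
  · exact ⟨b * a, by rw [h, map_mul]⟩
  · exact ⟨a * b * a, by rw [h, map_mul, map_mul]⟩
  · exact ⟨a * a, by rw [h, map_mul]⟩
  · exact ⟨b * b, by rw [h, map_mul]⟩

/-- An identity failing in a model of the basis would fail in `S₃` after a separating homomorphism.
A proper subvariety is commutative, and then its power identities with exponents reduced modulo 6
determine it. -/
theorem isCross_varietyS3 : varietyS3.IsCross := by
  refine ⟨⟨{(varX ^ 6, varX ^ 0), (varX ^ 2 * varY ^ 2, varY ^ 2 * varX ^ 2)}, Set.toFinite _, ?_⟩,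
    ⟨MonCat.of (Equiv.Perm (Fin 3)), inferInstanceAs (Finite (Equiv.Perm (Fin 3))), rfl⟩, ?_⟩
  · refine MonoidVariety.isBasis_of_identities ?_ ?_
    · rintro e (rfl | rfl)
      exacts [varietyS3_pow, varietyS3_sq_comm]
    · rintro M _ hM e he θ
      by_contra hne
      obtain ⟨φ, hφ⟩ := exists_monoidHom_perm (hM _ (Or.inl rfl)) (hM _ (Or.inr rfl)) hne
      apply hφ
      rw [FreeMonoid.hom_map_lift, FreeMonoid.hom_map_lift]
      exact mem_identities_varietyS3.1 he _
  · refine MonoidVariety.isSmall_of_finite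
      (insert (varX * varY, varY * varX) (MonoidVariety.powIdentities 6))
      ((MonoidVariety.finite_powIdentities 6).insert _) ?_
    intro U hU W hW h
    have hmod : ∀ V ≤ varietyS3, ∀ M ∈ V, ∀ m : M, ∀ a, m ^ a = m ^ (a % 6) := by
      intro V hV M hM m a
      have h6 : m ^ 6 = 1 := by
        simpa using satisfiesIdentity_pow_iff.1 
          (MonoidVariety.le_iff_identities.1 hV varietyS3_pow M hM) m
      conv_lhs => rw [← Nat.div_add_mod a 6, pow_add, pow_mul, h6, one_pow, one_mul]
    by_cases hcomm : (varX * varY, varY * varX) ∈ W.identities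
    · exact MonoidVariety.identities_subset_of_comm (r := fun a => a % 6) (B := 6)
        (fun a => Nat.mod_lt _ (by omega)) (hmod U hU) (hmod W hW) hcomm
        fun a ha b hb => h _ (Or.inr (MonoidVariety.mem_powIdentities ha hb))
    · have h1 := varietyS3_le_of_not_comm hU fun hc => hcomm (h _ (Or.inl rfl) hc)
      exact MonoidVariety.le_iff_identities.1 (hW.trans h1)

/-! ### First and last occurrences, and sorting them by adjacent swaps. -/

/-- The position of the letter `z` between `c` and `d` is a first (`b = false`) or a last
(`b = true`) occurrence. -/
def IsToken (c : List ℕ) (z : ℕ) (d : List ℕ) (b : Bool) : Prop :=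
  (b = false → z ∉ c) ∧ (b = true → z ∉ d)

/-- In the word `u`, preceded by the letters in `S`, the token `s` precedes the token `t`. -/
def TokenBefore (S u : List ℕ) (s t : ℕ × Bool) : Prop :=
  ∃ u₁ u₂ u₃, u = u₁ ++ s.1 :: (u₂ ++ t.1 :: u₃) ∧ IsToken (S ++ u₁) s.1 (u₂ ++ t.1 :: u₃) s.2 ∧
    IsToken (S ++ (u₁ ++ s.1 :: u₂)) t.1 u₃ t.2

/-- The sequence of the first occurrences `(x, false)` and of the last occurrences `(x, true)` of
letters in a word that is preceded by the letters in `S`; single occurrences count as first. -/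
def tokens (S : List ℕ) : List ℕ → List (ℕ × Bool)
  | [] => []
  | x :: l =>
    if x ∈ S then if x ∈ l then tokens S l else (x, true) :: tokens S l
    else (x, false) :: tokens (x :: S) l

theorem mem_tokens_false {S u : List ℕ} {x : ℕ} : (x, false) ∈ tokens S u ↔ x ∉ S ∧ x ∈ u := by
  induction u generalizing S with
  | nil => simp [tokens]
  | cons y u ih =>
    rw [tokens]
    split_ifs with h1 h2
    · rw [ih, List.mem_cons]
      constructor
      · exact fun h => ⟨h.1, Or.inr h.2⟩
      · rintro ⟨h, rfl | h'⟩
        exacts [absurd h1 h, ⟨h, h'⟩]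
    · rw [List.mem_cons, ih, List.mem_cons]
      constructor
      · rintro (h | h)
        · simp at h
        · exact ⟨h.1, Or.inr h.2⟩
      · rintro ⟨h, rfl | h'⟩
        exacts [absurd h1 h, Or.inr ⟨h, h'⟩]
    · rw [List.mem_cons, ih, List.mem_cons, List.mem_cons, Prod.mk.injEq]
      by_cases hxy : x = y
      · subst hxy
        simp [h1]
      · simp [hxy]

theorem mem_tokens_true {S u : List ℕ} {x : ℕ} :
    (x, true) ∈ tokens S u ↔ x ∈ S ∧ x ∈ u ∨ x ∉ S ∧ 2 ≤ u.count x := by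
  induction u generalizing S with
  | nil => simp [tokens]
  | cons y u ih =>
    rw [tokens]
    by_cases hxy : x = y
    · subst hxy
      rw [List.count_cons_self]
      split_ifs with h1 h2
      · simp [ih, h1, h2]
      · simp [h1]
      · simp [ih, h1]
    · rw [List.count_cons_of_ne (Ne.symm hxy)]
      split_ifs with h1 h2 <;> simp [ih, hxy]

theorem nodup_tokens (S u : List ℕ) : (tokens S u).Nodup := by
  induction u generalizing S with
  | nil => simp [tokens]
  | cons y u ih =>
    rw [tokens]
    split_ifs with h1 h2
    · exact ih S
    · refine List.nodup_cons.2 ⟨fun h => ?_, ih S⟩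
      rcases mem_tokens_true.1 h with h | h
      exacts [h2 h.2, h.1 h1]
    · exact List.nodup_cons.2 ⟨fun h => (mem_tokens_false.1 h).1 List.mem_cons_self, ih (y :: S)⟩

theorem IsToken.mono {c c' d : List ℕ} {z : ℕ} {b : Bool} (h : IsToken c z d b)
    (hc : c' ⊆ c) : IsToken c' z d b :=
  ⟨fun hb hz => h.1 hb (hc hz), h.2⟩

theorem append_cons_subset {x : ℕ} {S S' : List ℕ} (hx : x ∈ S') (hS : S ⊆ S') (c : List ℕ) :
    S ++ x :: c ⊆ S' ++ c := by
  intro y hy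
  rw [List.mem_append, List.mem_cons] at hy
  rw [List.mem_append]
  rcases hy with h | rfl | h
  exacts [Or.inl (hS h), Or.inl hx, Or.inr h]

theorem exists_of_mem_tokens {S u : List ℕ} {t : ℕ × Bool} (ht : t ∈ tokens S u) :
    ∃ c d, u = c ++ t.1 :: d ∧ IsToken (S ++ c) t.1 d t.2 := by
  induction u generalizing S with
  | nil => simp [tokens] at ht
  | cons y u ih =>
    have hshift : ∀ S' : List ℕ, y ∈ S' → S ⊆ S' → t ∈ tokens S' u →
        ∃ c d, y :: u = c ++ t.1 :: d ∧ IsToken (S ++ c) t.1 d t.2 := by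
      intro S' hy hS ht
      obtain ⟨c, d, rfl, h⟩ := ih ht
      exact ⟨y :: c, d, rfl, h.mono (append_cons_subset hy hS c)⟩
    rw [tokens] at ht
    split_ifs at ht with h1 h2
    · exact hshift S h1 (List.Subset.refl S) ht
    · rcases List.mem_cons.1 ht with rfl | ht
      · exact ⟨[], u, rfl, by simp [IsToken, h2]⟩
      · exact hshift S h1 (List.Subset.refl S) ht
    · rcases List.mem_cons.1 ht with rfl | ht
      · exact ⟨[], u, rfl, by simp [IsToken, h1]⟩
      · exact hshift (y :: S) List.mem_cons_self (List.subset_cons_self y S) ht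

theorem pairwise_tokens (S u : List ℕ) : (tokens S u).Pairwise (TokenBefore S u) := by
  induction u generalizing S with
  | nil => simp [tokens]
  | cons y u ih =>
    have hshift : ∀ S' : List ℕ, y ∈ S' → S ⊆ S' → ∀ s t, TokenBefore S' u s t →
        TokenBefore S (y :: u) s t := by
      rintro S' hy hS s t ⟨u₁, u₂, u₃, rfl, h, h'⟩
      exact ⟨y :: u₁, u₂, u₃, rfl, h.mono (append_cons_subset hy hS u₁),
        h'.mono (append_cons_subset hy hS _)⟩
    have hhead : ∀ S' : List ℕ, y ∈ S' → S ⊆ S' → ∀ b, IsToken S y u b → ∀ t ∈ tokens S' u,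
        TokenBefore S (y :: u) (y, b) t := by
      intro S' hy hS b hb t ht
      obtain ⟨c, d, hu, h⟩ := exists_of_mem_tokens ht
      exact ⟨[], c, d, by rw [hu]; rfl, by rw [← hu, List.append_nil]; exact hb,
        h.mono (append_cons_subset hy hS c)⟩
    rw [tokens]
    split_ifs with h1 h2
    · exact (ih S).imp fun {s t} => hshift S h1 (List.Subset.refl S) s t
    · refine List.pairwise_cons.2 ⟨?_, (ih S).imp fun {s t} => hshift S h1 (List.Subset.refl S) s t⟩
      exact hhead S h1 (List.Subset.refl S) true (by simp [IsToken, h2])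
    · refine List.pairwise_cons.2 ⟨?_, (ih (y :: S)).imp fun {s t} =>
        hshift (y :: S) List.mem_cons_self (List.subset_cons_self y S) s t⟩
      exact hhead (y :: S) List.mem_cons_self (List.subset_cons_self y S) false
        (by simp [IsToken, h1])

theorem not_tokenBefore_true_false (S u : List ℕ) (x : ℕ) :
    ¬ TokenBefore S u (x, true) (x, false) := by
  rintro ⟨u₁, u₂, u₃, -, h, -⟩
  exact h.2 rfl (by simp)

/-- `l'` results from `l` by exchanging two adjacent elements that are in the wrong order. -/
def SwapStep {α : Type*} (k : α → ℕ) (l l' : List α) : Prop :=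
  ∃ c q p d, l = c ++ q :: p :: d ∧ l' = c ++ p :: q :: d ∧ k p < k q

theorem SwapStep.cons {α : Type*} {k : α → ℕ} {l l' : List α} (a : α) (h : SwapStep k l l') :
    SwapStep k (a :: l) (a :: l') := by
  obtain ⟨c, q, p, d, rfl, rfl, h⟩ := h
  exact ⟨a :: c, q, p, d, rfl, rfl, h⟩

/-- Insertion sort only exchanges adjacent elements that are in the wrong order. -/
theorem reflTransGen_swapStep_insertionSort {α : Type*} (k : α → ℕ) (l : List α) :
    Relation.ReflTransGen (SwapStep k) l (l.insertionSort fun a b => k a ≤ k b) := by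
  induction l with
  | nil => exact Relation.ReflTransGen.refl
  | cons a l ih =>
    rw [List.insertionSort_cons]
    refine (ih.lift (a :: ·) fun _ _ h => h.cons a).trans ?_
    generalize l.insertionSort (fun a b => k a ≤ k b) = m
    induction m with
    | nil => exact Relation.ReflTransGen.refl
    | cons b m ihm =>
      rw [List.orderedInsert_cons]
      split_ifs with h
      · exact Relation.ReflTransGen.refl
      · exact Relation.ReflTransGen.head ⟨[], a, b, m, rfl, rfl, by omega⟩
          (ihm.lift (b :: ·) fun _ _ h => h.cons b)

section Evaluation

variable {M : Type*} [Monoid M] {θ : ℕ → M}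

theorem prod_map_delete (hβ : ∀ a b c : M, a * b * a * c * a = a * b * c * a) {c d : List ℕ} {x : ℕ}
    (hc : x ∈ c) (hd : x ∈ d) : ((c ++ x :: d).map θ).prod = ((c ++ d).map θ).prod := by
  obtain ⟨c₁, c₂, rfl⟩ := List.append_of_mem hc
  obtain ⟨d₁, d₂, rfl⟩ := List.append_of_mem hd
  have := hβ (θ x) (c₂.map θ).prod (d₁.map θ).prod
  calc _ = (c₁.map θ).prod * (θ x * (c₂.map θ).prod * θ x * (d₁.map θ).prod * θ x) *
        (d₂.map θ).prod := by simp [mul_assoc]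
    _ = _ := by rw [this]; simp [mul_assoc]

theorem prod_map_delete_list (hβ : ∀ a b c : M, a * b * a * c * a = a * b * c * a)
    {c d r : List ℕ} (h : ∀ z ∈ r, z ∈ c ∧ z ∈ d) :
    ((c ++ (r ++ d)).map θ).prod = ((c ++ d).map θ).prod := by
  induction r with
  | nil => rfl
  | cons z r ih =>
    rw [List.cons_append, prod_map_delete hβ (h z (by simp)).1
      (List.mem_append_right _ (h z (by simp)).2)]
    exact ih fun y hy => h y (by simp [hy])

/-- Occurrences that are neither first nor last can be deleted without changing the value; `S` has
the same letters as the prefix `c` already read. -/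
theorem prod_map_tokens (hβ : ∀ a b c : M, a * b * a * c * a = a * b * c * a) {S c u : List ℕ}
    (hS : ∀ y, y ∈ S ↔ y ∈ c) :
    ((c ++ u).map θ).prod = ((c ++ (tokens S u).map Prod.fst).map θ).prod := by
  induction u generalizing S c with
  | nil => simp [tokens]
  | cons y u ih =>
    have hcons : ∀ S' : List ℕ, (∀ z, z ∈ S' ↔ z ∈ c ++ [y]) → ((c ++ y :: u).map θ).prod =
        ((c ++ y :: (tokens S' u).map Prod.fst).map θ).prod := by
      intro S' hS'
      have := ih hS'
      rwa [List.append_assoc, List.append_assoc] at this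
    rw [tokens]
    split_ifs with h1 h2
    · rw [prod_map_delete hβ ((hS y).1 h1) h2]
      exact ih hS
    · refine hcons S fun z => ?_
      rw [hS z, List.mem_append, List.mem_singleton]
      exact ⟨Or.inl, fun h => h.elim id fun e => e ▸ (hS y).1 h1⟩
    · refine hcons (y :: S) fun z => ?_
      rw [List.mem_cons, hS z, List.mem_append, List.mem_singleton, or_comm]

/-- Around the token `s` of the word `u`, the other occurrences of its letter in `u` lie between
occurrences of the letter. -/
def TokenContext (c d u : List ℕ) (s : ℕ × Bool) : Prop :=
  (s.2 = true → s.1 ∈ c) ∧ (s.2 = false → 2 ≤ u.count s.1 → s.1 ∈ d)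

/-- Apart from the two tokens, each occurrence of the two letters lies between others of the same
letter, within `c`, `d` or the tokens themselves, and can be deleted. This lets a two-letter word be
inserted in place of two adjacent tokens. -/
theorem prod_map_filter_of_tokenBefore (hβ : ∀ a b c : M, a * b * a * c * a = a * b * c * a)
    {c d u : List ℕ} {s t : ℕ × Bool} (h : TokenBefore [] u s t) (hs : TokenContext c d u s)
    (ht : TokenContext c d u t) (hst : s.1 ≠ t.1) {P : ℕ → Bool}
    (hP : ∀ z, P z = true ↔ z = s.1 ∨ z = t.1) :
    ((c ++ (u.filter P ++ d)).map θ).prod = ((c ++ s.1 :: t.1 :: d).map θ).prod := by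
  obtain ⟨u₁, u₂, u₃, rfl, hs', ht'⟩ := h
  rw [List.nil_append] at hs' ht'
  obtain ⟨x, i⟩ := s
  obtain ⟨y, j⟩ := t
  simp only [IsToken, TokenContext] at *
  have hx1 : x ∈ u₁ → x ∈ c := fun hx => hs.1 (by
    by_contra hi
    exact hs'.1 (by simpa using hi) hx)
  have hx3 : x ∈ u₂ ∨ x ∈ u₃ → x ∈ d := by
    intro hx
    have hx := List.mem_append.2 (hx.imp_right (List.mem_cons_of_mem y))
    refine hs.2 ?_ ?_
    · by_contra hi
      exact hs'.2 (by simpa using hi) hx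
    · have : 0 < (u₂ ++ y :: u₃).count x := List.count_pos_iff.2 hx
      rw [List.count_append, List.count_cons_self]
      omega
  have hy1 : y ∈ u₁ ∨ y ∈ u₂ → y ∈ c := fun hy => ht.1 (by
    by_contra hi
    exact ht'.1 (by simpa using hi)
      (List.mem_append.2 (hy.imp_right (List.mem_cons_of_mem x))))
  have hy3 : y ∈ u₃ → y ∈ d := by
    intro hy
    refine ht.2 ?_ ?_
    · by_contra hi
      exact ht'.2 (by simpa using hi) hy
    · have : 0 < u₃.count y := List.count_pos_iff.2 hy
      rw [List.count_append, List.count_cons_of_ne hst, List.count_append, List.count_cons_self]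
      omega
  have hPx : P x = true := (hP x).2 (Or.inl rfl)
  have hPy : P y = true := (hP y).2 (Or.inr rfl)
  have hmem : ∀ l : List ℕ, ∀ z ∈ l.filter P, z ∈ l ∧ (z = x ∨ z = y) := fun l z hz =>
    ⟨(List.mem_filter.1 hz).1, (hP z).1 (List.mem_filter.1 hz).2⟩
  rw [List.filter_append, List.filter_cons_of_pos hPx, List.filter_append,
    List.filter_cons_of_pos hPy]
  have e1 : ((c ++ (u₁.filter P ++ (x :: (u₂.filter P ++ y :: (u₃.filter P ++ d))))).map θ).prod =
      ((c ++ (x :: (u₂.filter P ++ y :: (u₃.filter P ++ d)))).map θ).prod := by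
    refine prod_map_delete_list hβ fun z hz => ?_
    obtain ⟨hz, rfl | rfl⟩ := hmem _ z hz
    · exact ⟨hx1 hz, by simp⟩
    · exact ⟨hy1 (Or.inl hz), by simp⟩
  have e2 : (((c ++ [x]) ++ (u₂.filter P ++ y :: (u₃.filter P ++ d))).map θ).prod =
      (((c ++ [x]) ++ y :: (u₃.filter P ++ d)).map θ).prod := by
    refine prod_map_delete_list hβ fun z hz => ?_
    obtain ⟨hz, rfl | rfl⟩ := hmem _ z hz
    · exact ⟨by simp, by simp [hx3 (Or.inl hz)]⟩
    · exact ⟨by simp [hy1 (Or.inr hz)], by simp⟩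
  have e3 : (((c ++ [x, y]) ++ (u₃.filter P ++ d)).map θ).prod =
      (((c ++ [x, y]) ++ d).map θ).prod := by
    refine prod_map_delete_list hβ fun z hz => ?_
    obtain ⟨hz, rfl | rfl⟩ := hmem _ z hz
    · exact ⟨by simp, hx3 (Or.inr hz)⟩
    · exact ⟨by simp, hy3 hz⟩
  simp only [List.append_assoc, List.cons_append, List.nil_append] at e1 e2 e3 ⊢
  rw [e1, e2, e3]

end Evaluation

/-- Both words have the same tokens, so those of `u` can be sorted into the order of `v` by adjacent
swaps. A swap replaces the restriction of `u` to two letters by that of `v`, up to deletable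
occurrences, and `hpair` permits it. -/
theorem prod_map_eq_of_swaps {M : Type*} [Monoid M] {θ : ℕ → M}
    (hβ : ∀ a b c : M, a * b * a * c * a = a * b * c * a) {u v : List ℕ}
    (hcon : ∀ x, x ∈ u ↔ x ∈ v) (hlin : ∀ x, 2 ≤ u.count x ↔ 2 ≤ v.count x)
    (hpair : ∀ s t : ℕ × Bool, s.1 ≠ t.1 → TokenBefore [] u s t → TokenBefore [] v t s →
      ((u.filter fun z => z = s.1 ∨ z = t.1).map θ).prod =
        ((v.filter fun z => z = s.1 ∨ z = t.1).map θ).prod) :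
    (u.map θ).prod = (v.map θ).prod := by
  have hT : ∀ w : List ℕ, (w.map θ).prod = (((tokens [] w).map Prod.fst).map θ).prod := fun w =>
    prod_map_tokens hβ (S := []) (c := []) fun _ => Iff.rfl
  have hmem : ∀ t, t ∈ tokens [] u ↔ t ∈ tokens [] v := by
    rintro ⟨x, _ | _⟩
    · rw [mem_tokens_false, mem_tokens_false, hcon]
    · simp only [mem_tokens_true, hlin, List.not_mem_nil, false_and]
  have hperm : (tokens [] u).Perm (tokens [] v) :=
    (List.perm_ext_iff_of_nodup (nodup_tokens _ _) (nodup_tokens _ _)).2 hmem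
  set k : ℕ × Bool → ℕ := fun t => (tokens [] v).idxOf t with hk
  have hkv : ∀ s ∈ tokens [] v, ∀ t ∈ tokens [] v, k s < k t → TokenBefore [] v s t := by
    intro s hs t ht hst
    have h1 := List.pairwise_iff_getElem.1 (pairwise_tokens [] v) (k s) (k t)
      (List.idxOf_lt_length_iff.2 hs) (List.idxOf_lt_length_iff.2 ht) hst
    simpa [hk] using h1
  have hsort : (tokens [] u).insertionSort (fun a b => k a ≤ k b) = tokens [] v := by
    refine List.Perm.eq_of_pairwise (le := fun a b => k a ≤ k b) ?_
      (List.pairwise_insertionSort _ _) ?_ ((List.perm_insertionSort _ _).trans hperm)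
    · intro a b ha hb h1 h2
      rw [List.mem_insertionSort] at ha
      exact List.idxOf_inj ((hmem a).1 ha) |>.1 (le_antisymm h1 h2)
    · rw [List.pairwise_iff_getElem]
      intro i j hi hj hij
      simp only [hk, (nodup_tokens [] v).idxOf_getElem]
      exact hij.le
  -- The invariant says that each pair still stands in the order of `u` or already in that of `v`.
  -- So an adjacent pair about to be swapped is ordered oppositely in `u` and `v`, as `hpair`
  -- requires.
  have hinv : ∀ w, Relation.ReflTransGen (SwapStep k) (tokens [] u) w →
      w.Perm (tokens [] u) ∧ w.Pairwise (fun s t => TokenBefore [] u s t ∨ k s < k t) ∧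
        ((w.map Prod.fst).map θ).prod = (((tokens [] u).map Prod.fst).map θ).prod := by
    intro w hw
    induction hw with
    | refl => exact ⟨List.Perm.refl _, (pairwise_tokens [] u).imp fun h => Or.inl h, rfl⟩
    | tail _ hstep ih =>
      obtain ⟨c, q, p, d, rfl, rfl, hqp⟩ := hstep
      obtain ⟨hwp, hpw, hprod⟩ := ih
      have hqu : q ∈ tokens [] u := hwp.subset (by simp)
      have hpu : p ∈ tokens [] u := hwp.subset (by simp)
      have hbv : TokenBefore [] v p q := hkv p ((hmem p).1 hpu) q ((hmem q).1 hqu) hqp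
      have hpw' := hpw
      rw [List.pairwise_append, List.pairwise_cons, List.pairwise_cons] at hpw'
      obtain ⟨hc, ⟨hq, hp, hd⟩, hcd⟩ := hpw'
      have hbu : TokenBefore [] u q p := (hq p (by simp)).resolve_right (by omega)
      refine ⟨(List.Perm.append_left c (List.Perm.swap q p d)).trans hwp, ?_, ?_⟩
      · rw [List.pairwise_append, List.pairwise_cons, List.pairwise_cons]
        refine ⟨hc, ⟨fun t ht => ?_, fun t ht => hq t (by simp [ht]), hd⟩,
          fun s hs t ht => hcd s hs t ?_⟩
        · rcases List.mem_cons.1 ht with rfl | ht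
          exacts [Or.inr hqp, hp t ht]
        · simp only [List.mem_cons] at ht ⊢
          tauto
      · rw [← hprod]
        have hne : q ≠ p := fun e => by rw [e] at hqp; omega
        -- The two tokens of a letter never get reversed; if the letter has no last token, its index
        -- is the length of the list, which no index exceeds.
        have hno : ∀ x, ¬ (TokenBefore [] u (x, true) (x, false) ∨ k (x, true) < k (x, false)) := by
          rintro x (h | h)
          · exact not_tokenBefore_true_false _ _ _ h
          · by_cases hx : (x, true) ∈ tokens [] v
            · have hx' : (x, false) ∈ tokens [] v := by
                rw [mem_tokens_false]
                rcases mem_tokens_true.1 hx with h | h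
                · simp at h
                · exact ⟨by simp, List.count_pos_iff.1 (by omega)⟩
              exact not_tokenBefore_true_false _ _ _ (hkv _ hx _ hx' h)
            · have h1 : k (x, true) = (tokens [] v).length := List.idxOf_eq_length hx
              have h2 : k (x, false) ≤ (tokens [] v).length := List.idxOf_le_length
              omega
        have hne1 : q.1 ≠ p.1 := by
          intro e
          obtain ⟨x, i⟩ := q
          obtain ⟨y, j⟩ := p
          obtain rfl : x = y := e
          cases i <;> cases j
          · exact hne rfl
          · exact not_tokenBefore_true_false _ _ _ hbv
          · exact not_tokenBefore_true_false _ _ _ hbu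
          · exact hne rfl
        have hmemw : ∀ t, t ∈ tokens [] u → t = q ∨ t = p ∨ t ∈ c ∨ t ∈ d := by
          intro t ht
          have := hwp.mem_iff.2 ht
          simp only [List.mem_append, List.mem_cons] at this
          tauto
        -- The companion token of the same letter is neither `q` nor `p`, so it lies in `c` or `d`,
        -- and `hno` tells on which side.
        have hctx : ∀ t, t = q ∨ t = p → TokenContext (c.map Prod.fst) (d.map Prod.fst) u t := by
          rintro ⟨x, i⟩ ht
          have htu : (x, i) ∈ tokens [] u := by rcases ht with rfl | rfl <;> assumption
          have hother : ∀ b, b ≠ i → (x, b) ≠ q ∧ (x, b) ≠ p := by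
            intro b hb
            constructor <;> intro h <;> rcases ht with h' | h'
            · exact hb (congrArg Prod.snd (h.trans h'.symm))
            · exact hne1 (by rw [← h, ← h'])
            · exact hne1 (by rw [← h, ← h'])
            · exact hb (congrArg Prod.snd (h.trans h'.symm))
          constructor
          · rintro rfl
            have hx : (x, false) ∈ tokens [] u := by
              rw [mem_tokens_false]
              rcases mem_tokens_true.1 htu with h | h
              · simp at h
              · exact ⟨by simp, List.count_pos_iff.1 (by omega)⟩
            rcases hmemw _ hx with h | h | h | h
            · exact absurd h (hother false (by simp)).1
            · exact absurd h (hother false (by simp)).2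
            · exact List.mem_map.2 ⟨_, h, rfl⟩
            · rcases ht with rfl | rfl
              · exact absurd (hq _ (by simp [h])) (hno x)
              · exact absurd (hp _ h) (hno x)
          · rintro rfl h2
            have hx : (x, true) ∈ tokens [] u := mem_tokens_true.2 (Or.inr ⟨by simp, h2⟩)
            rcases hmemw _ hx with h | h | h | h
            · exact absurd h (hother true (by simp)).1
            · exact absurd h (hother true (by simp)).2
            · exact absurd (hcd _ h _ (by rcases ht with rfl | rfl <;> simp)) (hno x)
            · exact List.mem_map.2 ⟨_, h, rfl⟩
        have hctx' : ∀ t, t = q ∨ t = p → TokenContext (c.map Prod.fst) (d.map Prod.fst) v t :=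
          fun t ht => ⟨(hctx t ht).1, fun h1 h2 => (hctx t ht).2 h1 ((hlin _).2 h2)⟩
        have e1 := prod_map_filter_of_tokenBefore (θ := θ) hβ hbu (hctx q (Or.inl rfl))
          (hctx p (Or.inr rfl)) hne1 (P := fun z => decide (z = q.1 ∨ z = p.1)) (by simp)
        have e2 := prod_map_filter_of_tokenBefore (θ := θ) hβ hbv (hctx' p (Or.inr rfl))
          (hctx' q (Or.inl rfl)) hne1.symm (P := fun z => decide (z = q.1 ∨ z = p.1))
          (by simp [or_comm])
        have e3 := hpair q p hne1 hbu hbv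
        simp only [List.map_append, List.map_cons, List.prod_append, List.prod_cons] at e1 e2 e3 ⊢
        rw [← e1, ← e2, e3]
  have h := (hinv _ (reflTransGen_swapStep_insertionSort k (tokens [] u))).2.2
  rw [hsort] at h
  rw [hT u, hT v, h]

/-! ### The variety generated by `L₂¹`, `A₀¹` and `R₂¹`. -/

namespace MonoidVariety

/-- A variety generated by finitely many finite monoids is finitely generated. -/
theorem isFinitelyGenerated_range {ι : Type u} [Finite ι] (M : ι → MonCat.{u})
    (hM : ∀ i, Finite (M i)) : (generatedBy (Set.range M)).IsFinitelyGenerated := by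
  refine ⟨MonCat.of (∀ i, M i), inferInstanceAs (Finite (∀ i, M i)), ?_⟩
  apply le_antisymm
  · refine generatedBy_le_iff.2 ?_
    rintro _ ⟨i, rfl⟩
    exact (generatedBy _).image_mem (MonCat.of (∀ i, M i)) (M i) (Pi.evalMonoidHom _ i)
      (Function.surjective_eval i) (subset_generatedBy _ _ rfl)
  · refine generatedBy_le_iff.2 ?_
    rintro _ rfl
    exact (generatedBy _).prod_mem ι M fun i => subset_generatedBy _ _ ⟨i, rfl⟩

end MonoidVariety

theorem mem_identities_varietyLAR {e : MonoidWord × MonoidWord} :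
    e ∈ varietyLAR.identities ↔ SatisfiesIdentity (WithOne SemigroupL2) e ∧
      SatisfiesIdentity (WithOne SemigroupA0) e ∧ SatisfiesIdentity (WithOne SemigroupR2) e := by
  rw [varietyLAR, MonoidVariety.identities_generatedBy]
  simp

theorem isFinitelyGenerated_varietyLAR : varietyLAR.IsFinitelyGenerated := by
  have h : varietyLAR = MonoidVariety.generatedBy (Set.range ![MonCat.of (WithOne SemigroupL2),
      MonCat.of (WithOne SemigroupA0), MonCat.of (WithOne SemigroupR2)]) := by
    rw [varietyLAR, Matrix.range_cons, Matrix.range_cons, Matrix.range_cons, Matrix.range_empty,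
      Set.union_empty]
    rfl
  have hL : Finite SemigroupL2 :=
    Finite.of_surjective (fun b : Bool => if b then SemigroupL2.a else SemigroupL2.b) (by
      rintro (_ | _)
      exacts [⟨true, rfl⟩, ⟨false, rfl⟩])
  have hR : Finite SemigroupR2 :=
    Finite.of_surjective (fun b : Bool => if b then SemigroupR2.a else SemigroupR2.b) (by
      rintro (_ | _)
      exacts [⟨true, rfl⟩, ⟨false, rfl⟩])
  have hA : Finite SemigroupA0 :=
    Finite.of_surjective
      ![SemigroupA0.a, SemigroupA0.b, SemigroupA0.ba, SemigroupA0.zero] (by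
      rintro (_ | _ | _ | _)
      exacts [⟨0, rfl⟩, ⟨1, rfl⟩, ⟨2, rfl⟩, ⟨3, rfl⟩])
  rw [h]
  refine MonoidVariety.isFinitelyGenerated_range _ fun i => ?_
  fin_cases i
  · exact inferInstanceAs (Finite (Option SemigroupL2))
  · exact inferInstanceAs (Finite (Option SemigroupA0))
  · exact inferInstanceAs (Finite (Option SemigroupR2))

/-- The identity `xyxzx ≈ xyzx`. -/
def middleIdentity : MonoidWord × MonoidWord :=
  (varX * varY * varX * FreeMonoid.of 2 * varX, varX * varY * FreeMonoid.of 2 * varX)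

theorem satisfiesIdentity_middle_iff {M : Type*} [Monoid M] :
    SatisfiesIdentity M middleIdentity ↔ ∀ a b c : M, a * b * a * c * a = a * b * c * a := by
  constructor
  · intro h a b c
    have := h fun i => if i = 0 then a else if i = 1 then b else c
    simpa [middleIdentity, varX, varY] using this
  · intro h θ
    simpa [middleIdentity, varX, varY] using h (θ 0) (θ 1) (θ 2)

theorem varietyLAR_middle : middleIdentity ∈ varietyLAR.identities := by
  refine mem_identities_varietyLAR.2 ⟨?_, ?_, ?_⟩ <;> rw [satisfiesIdentity_middle_iff]
  · rintro (_ | _ | _) (_ | _ | _) (_ | _ | _) <;> rfl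
  · rintro (_ | _ | _ | _ | _) (_ | _ | _ | _ | _) (_ | _ | _ | _ | _) <;> rfl
  · rintro (_ | _ | _) (_ | _ | _) (_ | _ | _) <;> rfl

theorem pow_eq_of_middle {M : Type*} [Monoid M]
    (hβ : ∀ a b c : M, a * b * a * c * a = a * b * c * a) (m : M) (n : ℕ) :
    m ^ n = m ^ min n 2 := by
  have h23 : m ^ 3 = m ^ 2 := by
    have := hβ m 1 1
    simpa [pow_succ] using this
  rcases le_total n 2 with h | h
  · rw [min_eq_left h]
  · rw [min_eq_right h]
    induction n, h using Nat.le_induction with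
    | base => rfl
    | succ n _ ih => rw [pow_succ, ih, ← pow_succ, h23]

/-- The substitution of `p` for `x`, of `q` for `y` and of `1` for the other letters. -/
def pairEval {S : Type*} (x y : ℕ) (p q : S) (k : ℕ) : WithOne S :=
  if k = x then p else if k = y then q else 1

section Semantics

variable {u v : MonoidWord}

theorem prod_map_pairEval_eq_one {S : Type*} [Semigroup S] {x y : ℕ} (p q : S) {l : List ℕ}
    (hx : x ∉ l) (hy : y ∉ l) : (l.map (pairEval x y p q)).prod = 1 := by
  refine List.prod_eq_one fun m hm => ?_
  obtain ⟨k, hk, rfl⟩ := List.mem_map.1 hm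
  have h1 : k ≠ x := fun e => hx (e ▸ hk)
  have h2 : k ≠ y := fun e => hy (e ▸ hk)
  simp [pairEval, h1, h2]

theorem prod_map_L2 {x y : ℕ} (p q : SemigroupL2) {c d : List ℕ} (hx : x ∉ c) (hy : y ∉ c) :
    ((c ++ x :: d).map (pairEval x y p q)).prod = p := by
  have hl : ∀ (p : SemigroupL2) (m : WithOne SemigroupL2), (p : WithOne SemigroupL2) * m = p := by
    rintro p (_ | _) <;> rfl
  rw [List.map_append, List.prod_append, prod_map_pairEval_eq_one p q hx hy, one_mul, List.map_cons,
    List.prod_cons, pairEval, if_pos rfl, hl]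

theorem prod_map_R2 {x y : ℕ} (p q : SemigroupR2) {c d : List ℕ} (hx : x ∉ d) (hy : y ∉ d) :
    ((c ++ x :: d).map (pairEval x y p q)).prod = p := by
  have hr : ∀ (p : SemigroupR2) (m : WithOne SemigroupR2), m * (p : WithOne SemigroupR2) = p := by
    rintro p (_ | _) <;> rfl
  rw [List.map_append, List.prod_append, List.map_cons, List.prod_cons,
    prod_map_pairEval_eq_one p q hx hy, mul_one, pairEval, if_pos rfl, hr]

theorem pairEval_comm {S : Type*} {x y : ℕ} (hxy : x ≠ y) (p q : S) :
    pairEval x y p q = pairEval y x q p := by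
  funext k
  unfold pairEval
  split_ifs with h1 h2
  · exact absurd (h1.symm.trans h2) hxy
  all_goals rfl

/-- A pair of first occurrences, or of last occurrences, has the same order in both sides of an
identity of `L₂¹` and `R₂¹`. -/
theorem not_tokenBefore_of_L2 (h : SatisfiesIdentity (WithOne SemigroupL2) (u, v)) {x y : ℕ}
    (hxy : x ≠ y) (hu : TokenBefore [] u.toList (x, false) (y, false)) :
    ¬ TokenBefore [] v.toList (y, false) (x, false) := by
  rintro ⟨v₁, v₂, v₃, hv, h1, h2⟩
  obtain ⟨u₁, u₂, u₃, hu, h3, h4⟩ := hu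
  have := h (pairEval x y .a .b)
  rw [FreeMonoid.lift_apply, FreeMonoid.lift_apply] at this
  dsimp only at *
  have hy : y ∉ u₁ := fun hm => h4.1 rfl (by simp [hm])
  have hx : x ∉ v₁ := fun hm => h2.1 rfl (by simp [hm])
  have hx' : x ∉ u₁ := h3.1 rfl
  have hy' : y ∉ v₁ := h1.1 rfl
  rw [hu, prod_map_L2 _ _ hx' hy, hv, pairEval_comm hxy, prod_map_L2 _ _ hy' hx] at this
  cases this

theorem not_tokenBefore_of_R2 (h : SatisfiesIdentity (WithOne SemigroupR2) (u, v)) {x y : ℕ}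
    (hxy : x ≠ y) (hu : TokenBefore [] u.toList (x, true) (y, true)) :
    ¬ TokenBefore [] v.toList (y, true) (x, true) := by
  rintro ⟨v₁, v₂, v₃, hv, h1, h2⟩
  obtain ⟨u₁, u₂, u₃, hu, h3, h4⟩ := hu
  have := h (pairEval x y .a .b)
  rw [FreeMonoid.lift_apply, FreeMonoid.lift_apply] at this
  dsimp only at *
  have hx : x ∉ u₃ := fun hm => h3.2 rfl (by simp [hm])
  have hy : y ∉ v₃ := fun hm => h1.2 rfl (by simp [hm])
  rw [← List.cons_append, ← List.append_assoc] at hu hv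
  rw [hv, prod_map_R2 _ _ (h2.2 rfl) hy, hu, pairEval_comm hxy, prod_map_R2 _ _ (h4.2 rfl) hx] at this
  cases this

/-- Put `b` for `x` and `a` for `y`. If every `x` precedes every `y`, the value is `ba`; an
occurrence of `y` before one of `x` makes it zero. -/
theorem not_tokenBefore_of_A0 (h : SatisfiesIdentity (WithOne SemigroupA0) (u, v)) {x y : ℕ}
    (hxy : x ≠ y) (hu : TokenBefore [] u.toList (x, true) (y, false)) :
    ¬ TokenBefore [] v.toList (y, false) (x, true) := by
  rintro ⟨v₁, v₂, v₃, hv, -, -⟩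
  obtain ⟨u₁, u₂, u₃, hu, h3, h4⟩ := hu
  have := h (pairEval x y .b .a)
  rw [FreeMonoid.lift_apply, FreeMonoid.lift_apply] at this
  dsimp only at *
  have hidem : ∀ (x y : ℕ) (p q : SemigroupA0), p * p = p → ∀ l : List ℕ, y ∉ l →
      (l.map (pairEval x y p q)).prod = 1 ∨ (l.map (pairEval x y p q)).prod = p := by
    intro x y p q hp l hl
    induction l with
    | nil => exact Or.inl rfl
    | cons z l ih =>
      rw [List.mem_cons, not_or] at hl
      rw [List.map_cons, List.prod_cons]
      have hz : pairEval x y p q z = 1 ∨ pairEval x y p q z = p := by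
        unfold pairEval
        rw [if_neg (Ne.symm hl.1)]
        split_ifs <;> simp
      have hp' : (p : WithOne SemigroupA0) * p = p := by rw [← WithOne.coe_mul, hp]
      rcases hz with hz | hz <;> rcases ih hl.2 with ih | ih <;> rw [hz, ih] <;> simp [hp']
  have hzero : ∀ α β γ : WithOne SemigroupA0,
      α * (((SemigroupA0.a : SemigroupA0) : WithOne SemigroupA0) *
        (β * (((SemigroupA0.b : SemigroupA0) : WithOne SemigroupA0) * γ))) =
          ((SemigroupA0.zero : SemigroupA0) : WithOne SemigroupA0) := by
    rintro (_ | _ | _ | _ | _) (_ | _ | _ | _ | _) (_ | _ | _ | _ | _) <;> rfl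
  have hyu : y ∉ u₁ ++ x :: u₂ := h4.1 rfl
  have hxu : x ∉ y :: u₃ := fun hm => h3.2 rfl (List.mem_append_right _ hm)
  rw [hv] at this
  rw [← List.cons_append, ← List.append_assoc] at hu
  rw [hu] at this
  simp only [List.map_append, List.map_cons, List.prod_append, List.prod_cons] at this
  have hex : pairEval x y SemigroupA0.b SemigroupA0.a x = (SemigroupA0.b : SemigroupA0) := by
    simp [pairEval]
  have hey : pairEval x y SemigroupA0.b SemigroupA0.a y = (SemigroupA0.a : SemigroupA0) := by
    simp [pairEval, hxy.symm]
  rw [hex, hey, hzero] at this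
  have h5 := hidem x y .b .a rfl u₁ fun hm => hyu (by simp [hm])
  have h6 := hidem x y .b .a rfl u₂ fun hm => hyu (by simp [hm])
  have h7 := hidem y x .a .b rfl u₃ fun hm => hxu (by simp [hm])
  rw [← pairEval_comm hxy] at h7
  rcases h5 with h5 | h5 <;> rcases h6 with h6 | h6 <;> rcases h7 with h7 | h7 <;>
    rw [h5, h6, h7] at this <;> cases this

/-- The powers `1`, `ba` and `(ba)² = 0` are distinct. -/
theorem min_count_eq_of_A0 (h : SatisfiesIdentity (WithOne SemigroupA0) (u, v)) (x : ℕ) :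
    min (u.toList.count x) 2 = min (v.toList.count x) 2 := by
  have hβ := satisfiesIdentity_middle_iff.1 (mem_identities_varietyLAR.1 varietyLAR_middle).2.1
  have := h.pow_count x ((SemigroupA0.ba : SemigroupA0) : WithOne SemigroupA0)
  rw [pow_eq_of_middle hβ, pow_eq_of_middle hβ _ (v.toList.count x)] at this
  have h1 : min (u.toList.count x) 2 ≤ 2 := min_le_right _ _
  have h2 : min (v.toList.count x) 2 ≤ 2 := min_le_right _ _
  generalize min (u.toList.count x) 2 = i at *
  generalize min (v.toList.count x) 2 = j at *
  interval_cases i <;> interval_cases j <;> first | rfl | cases this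

theorem not_tokenBefore_of_varietyLAR (h : (u, v) ∈ varietyLAR.identities) {s t : ℕ × Bool}
    (hst : s.1 ≠ t.1) (hu : TokenBefore [] u.toList s t) : ¬ TokenBefore [] v.toList t s := by
  obtain ⟨hL, hA, hR⟩ := mem_identities_varietyLAR.1 h
  obtain ⟨x, _ | _⟩ := s <;> obtain ⟨y, _ | _⟩ := t
  · exact not_tokenBefore_of_L2 hL hst hu
  · exact fun hv => not_tokenBefore_of_A0 (fun θ => (hA θ).symm) (Ne.symm hst) hv hu
  · exact not_tokenBefore_of_A0 hA hst hu
  · exact not_tokenBefore_of_R2 hR hst hu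

end Semantics

/-- Truncated counts determine the set of tokens, so only the order of tokens can differ. Each
reversal is repaired by the two-letter consequence of the identity. -/
theorem satisfiesIdentity_of_pairs {M : Type*} [Monoid M] (hM : SatisfiesIdentity M middleIdentity)
    {u v : MonoidWord} (hmin : ∀ x, min (u.toList.count x) 2 = min (v.toList.count x) 2)
    (hpair : ∀ s t : ℕ × Bool, s.1 ≠ t.1 → TokenBefore [] u.toList s t →
      TokenBefore [] v.toList t s → SatisfiesIdentity M
        (FreeMonoid.ofList (u.toList.flatMap (pairSub s.1 t.1)),
          FreeMonoid.ofList (v.toList.flatMap (pairSub s.1 t.1)))) :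
    SatisfiesIdentity M (u, v) := by
  intro θ
  rw [FreeMonoid.lift_apply, FreeMonoid.lift_apply]
  refine prod_map_eq_of_swaps (satisfiesIdentity_middle_iff.1 hM) (fun x => ?_) (fun x => ?_) ?_
  · have := hmin x
    dsimp only
    rw [← List.count_pos_iff, ← List.count_pos_iff]
    omega
  · have := hmin x
    dsimp only
    omega
  · intro s t hst hu hv
    have key : ∀ l : List ℕ, (FreeMonoid.lift fun k => if k = 0 then θ s.1 else θ t.1)
        (FreeMonoid.ofList (l.flatMap (pairSub s.1 t.1))) =
          ((l.filter fun z => z = s.1 ∨ z = t.1).map θ).prod := by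
      intro l
      rw [FreeMonoid.lift_ofList]
      induction l with
      | nil => rfl
      | cons z l ih =>
        rw [List.flatMap_cons, List.map_append, List.prod_append, ih, List.filter_cons]
        by_cases h1 : z = s.1
        · simp [pairSub, h1]
        · by_cases h2 : z = t.1
          · simp [pairSub, h2, hst.symm]
          · simp [pairSub, h1, h2]
    rw [← key, ← key]
    exact hpair s t hst hu hv _

/-- The pairs of words of length at most four in the letters `x` and `y`. -/
def shortIdentities : Set (MonoidWord × MonoidWord) :=
  {e | (e.1.toList.length ≤ 4 ∧ ∀ k ∈ e.1.toList, k < 2) ∧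
    e.2.toList.length ≤ 4 ∧ ∀ k ∈ e.2.toList, k < 2}

theorem finite_shortIdentities : shortIdentities.Finite := by
  have h : {w : MonoidWord | w.toList.length ≤ 4 ∧ ∀ k ∈ w.toList, k < 2}.Finite := by
    refine ((List.finite_length_le (Fin 2) 4).image
      fun l => FreeMonoid.ofList (l.map Fin.val)).subset ?_
    rintro w ⟨hw, hw'⟩
    refine ⟨w.toList.pmap Fin.mk hw', by simpa using hw, ?_⟩
    apply FreeMonoid.toList.injective
    simp [List.map_pmap]
  exact (h.prod h).subset fun e he => he

/-- Two letters have at most four tokens, which explains the bound four. -/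
theorem exists_short_word (w : List ℕ) (hw : ∀ k ∈ w, k < 2) :
    ∃ w' : MonoidWord, (w'.toList.length ≤ 4 ∧ ∀ k ∈ w'.toList, k < 2) ∧
      ∀ M : Type, ∀ [Monoid M], SatisfiesIdentity M middleIdentity →
        SatisfiesIdentity M (FreeMonoid.ofList w, w') := by
  have hmem : ∀ t ∈ tokens [] w, t.1 ∈ w := fun t ht => by
    obtain ⟨c, d, h, -⟩ := exists_of_mem_tokens ht
    rw [h]
    simp
  refine ⟨FreeMonoid.ofList ((tokens [] w).map Prod.fst), ⟨?_, ?_⟩, ?_⟩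
  · have h1 : (tokens [] w).toFinset ⊆ Finset.range 2 ×ˢ Finset.univ := by
      intro t ht
      simpa using hw _ (hmem t (List.mem_toFinset.1 ht))
    have h2 := Finset.card_le_card h1
    rw [List.toFinset_card_of_nodup (nodup_tokens _ _)] at h2
    simpa using h2
  · intro k hk
    obtain ⟨t, ht, rfl⟩ := List.mem_map.1 hk
    exact hw _ (hmem t ht)
  · intro M _ hM θ
    rw [FreeMonoid.lift_ofList, FreeMonoid.lift_ofList]
    exact prod_map_tokens (satisfiesIdentity_middle_iff.1 hM) (S := []) (c := []) fun _ => Iff.rfl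

theorem lt_two_of_mem_flatMap_pairSub {i j k : ℕ} {l : List ℕ} (h : k ∈ l.flatMap (pairSub i j)) :
    k < 2 := by
  obtain ⟨z, -, hz⟩ := List.mem_flatMap.1 h
  unfold pairSub at hz
  split_ifs at hz <;> simp at hz <;> omega

/-- Identities of the generators reverse no pair of tokens, so the middle identity alone is a basis.
In a subvariety, identities with equal truncated counts reduce to two-letter words of length at most
four; the remaining ones force idempotency or triviality. -/
theorem isCross_varietyLAR : varietyLAR.IsCross := by
  refine ⟨⟨{middleIdentity}, Set.finite_singleton _, ?_⟩, isFinitelyGenerated_varietyLAR, ?_⟩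
  · refine MonoidVariety.isBasis_of_identities ?_ ?_
    · rintro _ rfl
      exact varietyLAR_middle
    · rintro M _ hM ⟨u, v⟩ huv
      exact satisfiesIdentity_of_pairs (hM _ rfl)
        (min_count_eq_of_A0 (mem_identities_varietyLAR.1 huv).2.1)
        fun s t hst hu hv => absurd hv (not_tokenBefore_of_varietyLAR huv hst hu)
  · refine MonoidVariety.isSmall_of_finite (shortIdentities ∪ MonoidVariety.powIdentities 3)
      (finite_shortIdentities.union (MonoidVariety.finite_powIdentities 3)) ?_
    rintro U hU W hW h ⟨u, v⟩ huv
    have hmU : ∀ M ∈ U, SatisfiesIdentity M middleIdentity :=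
      MonoidVariety.le_iff_identities.1 hU varietyLAR_middle
    have hmW : ∀ M ∈ W, SatisfiesIdentity M middleIdentity :=
      MonoidVariety.le_iff_identities.1 hW varietyLAR_middle
    have hshort : ∀ w w' : List ℕ, (∀ k ∈ w, k < 2) → (∀ k ∈ w', k < 2) →
        (FreeMonoid.ofList w, FreeMonoid.ofList w') ∈ U.identities →
          (FreeMonoid.ofList w, FreeMonoid.ofList w') ∈ W.identities := by
      intro w w' hw hw' hmem
      obtain ⟨a, ha, ha'⟩ := exists_short_word w hw
      obtain ⟨b, hb, hb'⟩ := exists_short_word w' hw'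
      have h1 : (a, b) ∈ U.identities := fun M hM θ =>
        (ha' M (hmU M hM) θ).symm.trans ((hmem M hM θ).trans (hb' M (hmU M hM) θ))
      have h2 := h (a, b) (Or.inl ⟨ha, hb⟩) h1
      exact fun M hM θ =>
        (ha' M (hmW M hM) θ).trans ((h2 M hM θ).trans (hb' M (hmW M hM) θ).symm)
    have hpairs : ∀ u v : MonoidWord, (u, v) ∈ U.identities →
        (∀ x, min (u.toList.count x) 2 = min (v.toList.count x) 2) →
          (u, v) ∈ W.identities := by
      intro u v huv hmin M hM
      refine satisfiesIdentity_of_pairs (hmW M hM) hmin fun s t _ _ _ => ?_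
      refine hshort _ _ (fun k => lt_two_of_mem_flatMap_pairSub)
        (fun k => lt_two_of_mem_flatMap_pairSub) (fun N hN => ?_) M hM
      have := (huv N hN).subst fun k => FreeMonoid.ofList (pairSub s.1 t.1 k)
      rwa [← FreeMonoid.ofList_toList (FreeMonoid.lift _ u), toList_lift_pairSub,
        ← FreeMonoid.ofList_toList (FreeMonoid.lift _ v), toList_lift_pairSub] at this
    by_cases hmin : ∀ x, min (u.toList.count x) 2 = min (v.toList.count x) 2
    · exact hpairs u v huv hmin
    have hpowU : ∀ x, ∀ M ∈ U, ∀ m : M,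
        m ^ min (u.toList.count x) 2 = m ^ min (v.toList.count x) 2 := by
      intro x M hM m
      have hβ := satisfiesIdentity_middle_iff.1 (hmU M hM)
      rw [← pow_eq_of_middle hβ, ← pow_eq_of_middle hβ]
      exact (huv M hM).pow_count x m
    have hpowW : ∀ x, ∀ M ∈ W, ∀ m : M,
        m ^ min (u.toList.count x) 2 = m ^ min (v.toList.count x) 2 := fun x M hM =>
      satisfiesIdentity_pow_iff.1 (h _ (Or.inr (MonoidVariety.mem_powIdentities (by omega)
        (by omega))) (fun N hN => satisfiesIdentity_pow_iff.2 (hpowU x N hN)) M hM)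
    by_cases hcon : ∀ x, u.toList.count x = 0 ↔ v.toList.count x = 0
    · push Not at hmin
      obtain ⟨x, hx⟩ := hmin
      -- Equal contents with different truncated counts force `x ≈ x²`. Squaring every letter then
      -- leaves values unchanged and makes the truncated counts agree, which reduces to `hpairs`.
      have hidem : ∀ V : MonoidVariety.{0}, (∀ M ∈ V, ∀ m : M,
          m ^ min (u.toList.count x) 2 = m ^ min (v.toList.count x) 2) →
            ∀ M ∈ V, ∀ m : M, m ^ 2 = m := by
        intro V hV M hM m
        have h1 := hV M hM m
        have h2 := hcon x
        have h3 : min (u.toList.count x) 2 = 1 ∧ min (v.toList.count x) 2 = 2 ∨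
            min (u.toList.count x) 2 = 2 ∧ min (v.toList.count x) 2 = 1 := by omega
        rcases h3 with ⟨h3, h4⟩ | ⟨h3, h4⟩ <;> rw [h3, h4, pow_one] at h1
        exacts [h1.symm, h1]
      have hcount : ∀ (w : MonoidWord) (x : ℕ),
          (FreeMonoid.lift (fun k => FreeMonoid.of k ^ 2) w).toList.count x =
            2 * w.toList.count x := by
        intro w x
        rw [toList_lift_word]
        induction w.toList with
        | nil => rfl
        | cons z l ih =>
          rw [List.flatMap_cons, List.count_append, ih, List.count_cons,
            show (FreeMonoid.of z ^ 2).toList = [z, z] from rfl]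
          by_cases hz : z = x
          · simp [hz]
            omega
          · simp [hz]
      have h2 := hpairs (FreeMonoid.lift (fun k => FreeMonoid.of k ^ 2) u)
        (FreeMonoid.lift (fun k => FreeMonoid.of k ^ 2) v)
        (fun M hM => (huv M hM).subst _) (fun y => by
          rw [hcount, hcount]
          have := hcon y
          omega)
      intro M hM θ
      have h3 : ∀ w : MonoidWord,
          FreeMonoid.lift θ (FreeMonoid.lift (fun k => FreeMonoid.of k ^ 2) w) =
            FreeMonoid.lift θ w := by
        intro w
        rw [FreeMonoid.hom_map_lift]
        congr 2
        funext k
        simp [hidem W (hpowW x) M hM]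
      exact (h3 u).symm.trans ((h2 M hM θ).trans (h3 v))
    -- A letter on one side only gives `m = 1` or `m² = 1` for all `m`; with `m³ = m²` the monoid is
    -- trivial.
    · push Not at hcon
      obtain ⟨x, hx⟩ := hcon
      intro M hM
      have hone : ∀ m : M, m = 1 := by
        intro m
        have h1 := hpowW x M hM m
        have h23 := pow_eq_of_middle (satisfiesIdentity_middle_iff.1 (hmW M hM)) m 3
        have h4 : ∀ i, i ≠ 0 → m ^ min i 2 = 1 → m = 1 := by
          intro i hi hm
          have h5 : min i 2 = 1 ∨ min i 2 = 2 := by omega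
          rcases h5 with h5 | h5 <;> rw [h5] at hm
          · rwa [pow_one] at hm
          · rwa [show min 3 2 = 2 from rfl, pow_succ, hm, one_mul] at h23
        rcases hx with ⟨hx, hx'⟩ | ⟨hx, hx'⟩
        · rw [hx, Nat.zero_min, pow_zero] at h1
          exact h4 _ hx' h1.symm
        · rw [hx', Nat.zero_min, pow_zero] at h1
          exact h4 _ hx h1
      intro θ
      rw [hone (FreeMonoid.lift θ _), hone (FreeMonoid.lift θ _)]

/-! ### The joins with `𝕄(x²)`. -/

/-- An identity of `𝖬(x²)` with left side `xyxy` has two occurrences each of `x` and `y` on its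
right side. -/
theorem eq_of_satisfiesIdentity_varX_sq {w : MonoidWord}
    (h : SatisfiesIdentity (ReesMonoid {varX ^ 2}) (wordXYXY, w)) :
    w.toList ∈ [[0, 1, 0, 1], [0, 0, 1, 1], [0, 1, 1, 0], [1, 0, 0, 1], [1, 0, 1, 0],
      [1, 1, 0, 0]] := by
  have hperm : w.toList.Perm [0, 1, 0, 1] := by
    rw [List.perm_iff_count]
    intro i
    have h1 := count_of_reesMonoid_varX_sq h i
    rw [toList_wordXYXY] at h1
    have h2 : [0, 1, 0, 1].count i ≤ 2 := by
      simp only [List.count_cons, List.count_nil, beq_iff_eq]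
      split_ifs <;> omega
    omega
  rw [← List.mem_permutations'] at hperm
  revert hperm
  generalize w.toList = l
  revert l
  decide

/-- For two distinct transpositions `xyxy` is a 3-cycle, `yxyx` is its inverse, and the other four
arrangements evaluate to the identity. -/
theorem reesMonoid_xyxy_mem_join_S3 :
    MonCat.of (ReesMonoid {wordXYXY}) ∈ varietyS3 ⊔ reesVariety {varX ^ 2} := by
  refine reesMonoid_mem_of_isoterm fun w hw => ?_
  have h1 := MonoidVariety.le_iff_identities.1 (le_sup_left (b := reesVariety {varX ^ 2})) hw
  have h2 := MonoidVariety.le_iff_identities.1 (le_sup_right (a := varietyS3)) hw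
  rw [identities_reesVariety] at h2
  have h3 := mem_identities_varietyS3.1 h1
    fun i => if i = 0 then Equiv.swap 0 1 else Equiv.swap 1 2
  rw [FreeMonoid.lift_apply, FreeMonoid.lift_apply, toList_wordXYXY] at h3
  have h4 := eq_of_satisfiesIdentity_varX_sq h2
  simp only [List.mem_cons, List.not_mem_nil, or_false] at h4
  rcases h4 with h4 | h4 | h4 | h4 | h4 | h4
  · exact FreeMonoid.toList.injective h4
  all_goals
    rw [h4] at h3
    exact absurd h3 (by decide)

/-- `L₂¹` fixes the first letter and `R₂¹` the last, which leaves only `xxyy` to exclude; in `A₀¹`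
it takes the value `ba`, whereas `xyxy` takes the value zero. -/
theorem reesMonoid_xyxy_mem_join_LAR :
    MonCat.of (ReesMonoid {wordXYXY}) ∈ varietyLAR ⊔ reesVariety {varX ^ 2} := by
  refine reesMonoid_mem_of_isoterm fun w hw => ?_
  have h1 := MonoidVariety.le_iff_identities.1 (le_sup_left (b := reesVariety {varX ^ 2})) hw
  have h2 := MonoidVariety.le_iff_identities.1 (le_sup_right (a := varietyLAR)) hw
  rw [identities_reesVariety] at h2
  obtain ⟨hL, hA, hR⟩ := mem_identities_varietyLAR.1 h1
  have hL := hL (pairEval 0 1 .a .b)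
  have hA := hA (pairEval 0 1 .b .a)
  have hR := hR (pairEval 0 1 .a .b)
  rw [FreeMonoid.lift_apply, FreeMonoid.lift_apply, toList_wordXYXY] at hL hA hR
  have h4 := eq_of_satisfiesIdentity_varX_sq h2
  simp only [List.mem_cons, List.not_mem_nil, or_false] at h4
  rcases h4 with h4 | h4 | h4 | h4 | h4 | h4
  · exact FreeMonoid.toList.injective h4
  all_goals
    rw [h4] at hL hA hR
    first | (cases hA; done) | (cases hL; done) | cases hR

theorem isOfTypeContinuum_and_not_hasACC_join {U : MonoidVariety.{0}}
    (hU : U = varietyS3 ∨ U = varietyLAR) :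
    MonCat.of (ReesMonoid {varX * varY * varX * varY}) ∈ U ⊔ reesVariety {varX ^ 2} ∧
      (U ⊔ reesVariety {varX ^ 2}).IsOfTypeContinuum ∧ ¬ (U ⊔ reesVariety {varX ^ 2}).HasACC := by
  have h : MonCat.of (ReesMonoid {wordXYXY}) ∈ U ⊔ reesVariety {varX ^ 2} := by
    rcases hU with rfl | rfl
    exacts [reesMonoid_xyxy_mem_join_S3, reesMonoid_xyxy_mem_join_LAR]
  exact ⟨h, MonoidVariety.isOfTypeContinuum_of_mem h, MonoidVariety.not_hasACC_of_mem h⟩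

theorem mainTheorem6 :
    -- the two joins are the varieties generated by the respective monoids together
    varietyS3 ⊔ reesVariety {varX ^ 2} =
      MonoidVariety.generatedBy
        {MonCat.of (Equiv.Perm (Fin 3)), MonCat.of (ReesMonoid {varX ^ 2})} ∧
    varietyLAR ⊔ reesVariety {varX ^ 2} =
      MonoidVariety.generatedBy
        {MonCat.of (WithOne SemigroupL2), MonCat.of (WithOne SemigroupA0),
          MonCat.of (WithOne SemigroupR2), MonCat.of (ReesMonoid {varX ^ 2})} ∧
    -- the three varieties that are joined are Cross
    varietyS3.IsCross ∧ varietyLAR.IsCross ∧ (reesVariety {varX ^ 2}).IsCross ∧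
    -- and hence satisfy the ascending chain condition
    varietyS3.HasACC ∧ varietyLAR.HasACC ∧ (reesVariety {varX ^ 2}).HasACC ∧
    -- both joins contain the Rees quotient of `xyxy`, are of type continuum, and violate the
    -- ascending chain condition
    (∀ U : MonoidVariety.{0}, U = varietyS3 ∨ U = varietyLAR →
      MonCat.of (ReesMonoid {varX * varY * varX * varY}) ∈ U ⊔ reesVariety {varX ^ 2} ∧
      (U ⊔ reesVariety {varX ^ 2}).IsOfTypeContinuum ∧
      ¬ (U ⊔ reesVariety {varX ^ 2}).HasACC) ∧
    -- the join of two finitely generated small varieties can be of type continuum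
    (∃ U V : MonoidVariety.{0}, U.IsFinitelyGenerated ∧ U.IsSmall ∧
      V.IsFinitelyGenerated ∧ V.IsSmall ∧ (U ⊔ V).IsOfTypeContinuum) ∧
    -- the join of two varieties with the ascending chain condition can violate it
    (∃ U V : MonoidVariety.{0}, U.HasACC ∧ V.HasACC ∧ ¬ (U ⊔ V).HasACC) ∧
    -- both phenomena occur together for Cross varieties
    (∃ U V : MonoidVariety.{0}, U.IsCross ∧ V.IsCross ∧
      (U ⊔ V).IsOfTypeContinuum ∧ ¬ (U ⊔ V).HasACC) := by
  have hS := isCross_varietyS3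
  have hL := isCross_varietyLAR
  have hX := isCross_reesVariety_varX_sq
  have hjoin := isOfTypeContinuum_and_not_hasACC_join (U := varietyS3) (Or.inl rfl)
  refine ⟨?_, ?_, hS, hL, hX, hS.small.hasACC, hL.small.hasACC, hX.small.hasACC,
    fun U hU => isOfTypeContinuum_and_not_hasACC_join hU,
    ⟨_, _, hS.finitelyGenerated, hS.small, hX.finitelyGenerated, hX.small, hjoin.2.1⟩,
    ⟨_, _, hS.small.hasACC, hX.small.hasACC, hjoin.2.2⟩,
    ⟨_, _, hS, hX, hjoin.2.1, hjoin.2.2⟩⟩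
  · rw [varietyS3, reesVariety, MonoidVariety.generatedBy_sup, Set.singleton_union]
  · rw [varietyLAR, reesVariety, MonoidVariety.generatedBy_sup, Set.insert_union, Set.insert_union,
      Set.singleton_union]
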